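/- Let $\mathbb K$ be a first-order structure expanding an ordered field, where "definable" means definable with parameters, and assume that $\mathbb K$ is definably complete: every definable subset of $\mathbb K$ has a supremum in $\mathbb K\cup\{\pm\infty\}$. Give $\mathbb K$ the order topology and $\mathbb K^n$ the product topology. A definable increasing family of subsets of $\mathbb K^n$ is a family $(X_t)_{t\in\mathbb K}$ with $\{(t,x): x\in X_t\}$ definable and $X_s\subseteq X_t$ for $s\le t$. A definable set is pseudo-finite if it is closed, bounded and discrete; a set is nowhere dense if its closure has empty interior; meager if it is the union of a definable increasing family of nowhere dense sets; an $\mathcal F_\sigma$ set if it is definable and the union of a definable increasing family of closed sets; and constructible if it is a finite Boolean combination of open sets. $\mathbb K$ is definably Baire if it is not the union of a definable increasing family of nowhere dense subsets. The open core of $\mathbb K$ is the structure on the set $\mathbb K$ generated by all definable open subsets of $\mathbb K^n$, $n\in\mathbb N$. An expansion of an ordered field, or the open core, is locally o-minimal if for every definable (in it, with parameters) function $f:\mathbb K\to\mathbb K$ and every $x\in\mathbb K$ there is $y>x$ such that $f>0$ on $(x,y)$, or $f=0$ on $(x,y)$, or $f<0$ on $(x,y)$. The following are equivalent: 1. every definable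 discrete closed subset of $\mathbb K$ is pseudo-finite; 2. for every $n\in\mathbb N$, every definable discrete closed subset of $\mathbb K^n$ is pseudo-finite; 3. every definable discrete subset of $\mathbb K$ is pseudo-finite; 4. for every $n\in\mathbb N$, every definable discrete subset of $\mathbb K^n$ is pseudo-finite; 5. every definable nowhere dense subset of $\mathbb K$ is pseudo-finite; 6. every definable meager subset of $\mathbb K$ is pseudo-finite; 7. every definable nowhere dense subset of $\mathbb K$ is discrete; 8. the open core of $\mathbb K$ is locally o-minimal; 9. the union of any definable increasing family of pseudo-finite subsets of $\mathbb K$ is pseudo-finite; 10. for every $n\in\mathbb N$, the union of any definable increasing family of pseudo-finite subsets of $\mathbb K^n$ is pseudo-finite. Moreover, if these equivalent conditions hold, then for every $n\in\mathbb N$ every $\mathcal F_\sigma$ subset of $\mathbb K^n$ is constructible, $\mathbb K$ is definably Baire, and for every $n\in\mathbb N$ every meager subset of $\mathbb K^n$ is nowhere dense. -/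

import Mathlib

universe u v w

namespace DefComplete

open Set

section Definability

variable (L : FirstOrder.Language.{u, v}) {K : Type w} [L.Structure K]

/-- Definable (with parameters) subsets of `K ^ n`. -/
def Def {n : ℕ} (X : Set (Fin n → K)) : Prop :=
  (univ : Set K).Definable L X

/-- Definable (with parameters) subsets of `K`. -/
def Def₁ (X : Set K) : Prop :=
  (univ : Set K).Definable₁ L X

/-- A family `(X t)`, `t ∈ K`, of subsets of `K ^ n` is definable: the set of all pairs `(t, x)`
with `x ∈ X t` is a definable subset of `K ^ (n + 1)`. -/
def DefFamily {n : ℕ} (X : K → Set (Fin n → K)) : Prop :=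
  Def L {p : Fin (n + 1) → K | Fin.tail p ∈ X (p 0)}

/-- A family `(X t)`, `t ∈ K`, of subsets of `K` is definable: the set of all pairs `(t, x)`
with `x ∈ X t` is a definable subset of `K × K`. -/
def DefFamily₁ (X : K → Set K) : Prop :=
  (univ : Set K).Definable₂ L {p : K × K | p.2 ∈ X p.1}

/-- A function `K → K` is definable if its graph is. -/
def DefFun₁ (f : K → K) : Prop :=
  (univ : Set K).Definable₂ L {p : K × K | f p.1 = p.2}

end Definability

section Structures

variable (L : FirstOrder.Language.{u, v}) (K : Type w) [L.Structure K]

/-- The `L`-structure `K` expands the ordered field `K`: addition, multiplication and the order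
are definable in it (as they are if `L` has symbols for them). -/
structure ExpandsOrderedField [Field K] [LinearOrder K] : Prop where
  add : Def L {x : Fin 3 → K | x 0 + x 1 = x 2}
  mul : Def L {x : Fin 3 → K | x 0 * x 1 = x 2}
  lt : Def L {x : Fin 2 → K | x 0 < x 1}

/-- Every definable subset of `K` has a supremum in `K ∪ {-∞, +∞}`; the supremum is `-∞` for the
empty set and `+∞` for a set that is not bounded above, so only the other sets are mentioned. -/
def DefinablyComplete [LinearOrder K] : Prop :=
  ∀ X : Set K, Def₁ L X → X.Nonempty → BddAbove X → ∃ a, IsLUB X a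

/-- For every definable function `f : K → K`, the sign of `f` is constant to the right of each
point, on some nonempty open interval. -/
def LocallyOMinimal [Field K] [LinearOrder K] : Prop :=
  ∀ f : K → K, DefFun₁ L f → ∀ x : K, ∃ y > x,
    (∀ z ∈ Ioo x y, 0 < f z) ∨ (∀ z ∈ Ioo x y, f z = 0) ∨ (∀ z ∈ Ioo x y, f z < 0)

variable [TopologicalSpace K]

/-- The language of the open core: an `n`-ary relation symbol for each definable open subset of
`K ^ n`, for every `n`, and no function symbols. -/
def openCore : FirstOrder.Language where
  Functions _ := Empty
  Relations n := {U : Set (Fin n → K) // Def L U ∧ IsOpen U}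

/-- The open core of `K`: each symbol names the corresponding definable open set. -/
instance openCoreStructure : (openCore L K).Structure K where
  funMap f := Empty.elim f
  RelMap U x := x ∈ U.1

/-- `K` is definably Baire: it is not the union of a definable increasing family of nowhere dense
subsets. -/
def DefinablyBaire [LinearOrder K] : Prop :=
  ¬ ∃ Y : K → Set K, DefFamily₁ L Y ∧ Monotone Y ∧ (∀ t, IsNowhereDense (Y t)) ∧
    ⋃ t, Y t = univ

end Structures

/-- Pseudo-finite sets: closed, bounded and discrete. It is used for definable subsets of `K` and
of `K ^ n`; on `K ^ n`, bounded below and above for the product order means bounded in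
every coordinate. -/
def PseudoFinite {α : Type*} [Preorder α] [TopologicalSpace α] (X : Set α) : Prop :=
  IsClosed X ∧ (BddBelow X ∧ BddAbove X) ∧ IsDiscrete X

/-- Constructible sets: finite Boolean combinations of open sets. -/
def Constructible {α : Type*} [TopologicalSpace α] (X : Set α) : Prop :=
  X ∈ BooleanSubalgebra.closure {U : Set α | IsOpen U}

section Sets

variable (L : FirstOrder.Language.{u, v}) {K : Type w} [L.Structure K] [LinearOrder K] [TopologicalSpace K]

/-- A meager subset of `K`: the union of a definable increasing family of nowhere dense sets
(so it is definable). -/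
def Meager₁ (X : Set K) : Prop :=
  ∃ Y : K → Set K, DefFamily₁ L Y ∧ Monotone Y ∧ (∀ t, IsNowhereDense (Y t)) ∧ X = ⋃ t, Y t

/-- A meager subset of `K ^ n`: the union of a definable increasing family of nowhere dense sets
(so it is definable). -/
def Meager {n : ℕ} (X : Set (Fin n → K)) : Prop :=
  ∃ Y : K → Set (Fin n → K), DefFamily L Y ∧ Monotone Y ∧ (∀ t, IsNowhereDense (Y t)) ∧
    X = ⋃ t, Y t

/-- An `F_σ` subset of `K ^ n`: a definable set that is the union of a definable increasing family
of closed sets. -/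
def FSigma {n : ℕ} (X : Set (Fin n → K)) : Prop :=
  Def L X ∧ ∃ Y : K → Set (Fin n → K), DefFamily L Y ∧ Monotone Y ∧ (∀ t, IsClosed (Y t)) ∧
    X = ⋃ t, Y t

end Sets

end DefComplete

/-!
The ten conditions are shown equivalent to the first one, `DiscretePFin`: definable closed discrete
subsets of `K` are pseudo-finite (closed, bounded and discrete; `PFin` below).

The replacement for compactness is `exists_cluster`: in a definably complete field a bounded
definable family of nonempty sets that shrinks with `ε > 0` has a cluster point. Hence a shrinking
definable family of nonempty subsets of a pseudo-finite set has a common point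
(`PFin.exists_forall_mem`), and the image of a definable closed bounded set under a definable
continuous map is closed, so that definable `F_σ` sets are closed under projections (`FSig.image`).

Assume `DiscretePFin`. For an increasing definable family of pseudo-finite sets, the parameters at
which points enter the family form a closed discrete set; this set is bounded, so the family
stabilises (`DiscretePFin.exists_iUnion_eq`). For a closed nowhere dense subset of `K`, the inverses
of the lengths of its gaps near a point form a closed discrete set, so these lengths are bounded
below and the set has no accumulation point (`DiscretePFin.of_isNowhereDense`).

The passage to `K ^ n` rests on a definable pigeonhole principle,
`MeagerNowhereDense.exists_isNowhereDense_image`: if a projection of a definable set is somewhere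
dense, it remains so after the values of a definable function are confined to a suitable short
interval. It takes the place of the countable subdivisions of the classical arguments. With it a
version of the Kuratowski–Ulam theorem gives by induction on `n` that meager subsets of `K ^ n` are
nowhere dense (`MeagerNowhereDense.prod`), which contains the definable Baire property. It also
gives that the frontier of an `F_σ` set has smaller dimension than the set, where the dimension of
`A` is less than `d` if the projections of `A` to any `d` coordinates are nowhere dense
(`DiscretePFin.isNowhereDense_frontier`). By induction on the dimension, an `F_σ` set is
constructible and its complement is again `F_σ`
(`DiscretePFin.constructible_of_isNowhereDense`).

So the `F_σ` sets form a class closed under Boolean operations and projections that contains the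
definable open sets, and every set definable in the open core is `F_σ`
(`DiscretePFin.fSig_realize`). Membership in an `F_σ` subset of `K` is locally constant off a
pseudo-finite set, and this is local o-minimality of the open core. Conversely, an unbounded closed
discrete `D` yields the set of the inverses of its elements, which accumulates at `0` and
contradicts both local o-minimality and the discreteness of nowhere dense sets.
-/

set_option linter.unusedSectionVars false
-- Definability is proved by instance search, and the searches follow the size of the formulas.
set_option synthInstance.maxSize 20000
set_option synthInstance.maxHeartbeats 400000

namespace DefComplete

open Set Topology

/-! ### Definability by type-class search -/

/-- A space with finitely many coordinates in `K`: the uniform setting for `K`, the powers `ι → K`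
and products of such spaces. -/
class Coord (K : Type w) [TopologicalSpace K] (X : Type*) [TopologicalSpace X] where
  /-- The indices of the coordinates. -/
  Idx : Type
  finite_idx : Finite Idx
  /-- The coordinates of a point. -/
  co : X ≃ₜ (Idx → K)

attribute [instance] Coord.finite_idx

section Instances

variable {K : Type w} [TopologicalSpace K]

instance coordSelf : Coord K K where
  Idx := Fin 1
  finite_idx := inferInstance
  co := (Homeomorph.funUnique (Fin 1) K).symm

instance coordPi (ι : Type) [Finite ι] : Coord K (ι → K) where
  Idx := ι
  finite_idx := inferInstance
  co := Homeomorph.refl _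

instance coordProd (X Y : Type*) [TopologicalSpace X] [TopologicalSpace Y] [Coord K X]
    [Coord K Y] : Coord K (X × Y) where
  Idx := Coord.Idx K X ⊕ Coord.Idx K Y
  finite_idx := inferInstance
  co := ((Coord.co (K := K)).prodCongr (Coord.co (K := K))).trans
    (Homeomorph.sumArrowHomeomorphProdArrow).symm

end Instances

section Rules

variable (L : FirstOrder.Language.{u, v}) (K : Type w) [L.Structure K] [TopologicalSpace K]
variable {X Y Z : Type*} [TopologicalSpace X] [TopologicalSpace Y] [TopologicalSpace Z]
variable [Coord K X] [Coord K Y] [Coord K Z]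

/-- A predicate on a space with coordinates is definable (with parameters). The instances of this
class and of `DefMap` are the closure properties of definability, so that definability of a set
given by a first-order description is found by instance search. -/
class DefPred (P : X → Prop) : Prop where
  out : (univ : Set K).Definable L {v : Coord.Idx K X → K | P (Coord.co.symm v)}

/-- A map is definable if its graph is. -/
class DefMap (f : X → Y) : Prop where
  graph : DefPred L K fun p : X × Y => f p.1 = p.2

/-- A definable set. -/
class DefSet (A : Set X) : Prop where
  mem : DefPred L K fun x => x ∈ A

/-- A family of sets indexed by `K` that is definable. -/
class DefFam (F : K → Set X) : Prop where
  mem : DefPred L K fun p : K × X => p.2 ∈ F p.1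

variable {L K}

instance DefPred.and {P Q : X → Prop} [hP : DefPred L K P] [hQ : DefPred L K Q] :
    DefPred L K fun x => P x ∧ Q x :=
  ⟨hP.out.inter hQ.out⟩

instance DefPred.or {P Q : X → Prop} [hP : DefPred L K P] [hQ : DefPred L K Q] :
    DefPred L K fun x => P x ∨ Q x :=
  ⟨hP.out.union hQ.out⟩

instance DefPred.not {P : X → Prop} [hP : DefPred L K P] : DefPred L K fun x => ¬ P x :=
  ⟨hP.out.compl⟩

theorem DefPred.congr {P Q : X → Prop} (hP : DefPred L K P) (h : ∀ x, P x ↔ Q x) :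
    DefPred L K Q := by
  rwa [show Q = P from funext fun x => propext (h x).symm]

instance DefPred.imp {P Q : X → Prop} [hP : DefPred L K P] [hQ : DefPred L K Q] :
    DefPred L K fun x => P x → Q x :=
  DefPred.congr (P := fun x => ¬ P x ∨ Q x) inferInstance fun _ => imp_iff_not_or.symm

instance DefPred.const (p : Prop) : DefPred L K fun _ : X => p := by
  by_cases h : p
  · exact ⟨by simp only [h]; exact definable_univ⟩
  · exact ⟨by simp [h]⟩

instance DefPred.ex {P : X → Y → Prop} [hP : DefPred L K fun p : X × Y => P p.1 p.2] :
    DefPred L K fun x => ∃ y, P x y := by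
  refine ⟨?_⟩
  convert! hP.out.exists_of_finite using 1
  ext v
  have key (u : Coord.Idx K Y → K) : (Sum.elim v u ∈ {v : Coord.Idx K (X × Y) → K |
      P (Coord.co.symm v).1 (Coord.co.symm v).2}) ↔ P (Coord.co.symm v) (Coord.co.symm u) := Iff.rfl
  refine ⟨fun ⟨y, h⟩ => ⟨Coord.co y, (key _).2 ?_⟩, fun ⟨u, h⟩ => ⟨_, (key u).1 h⟩⟩
  rwa [Homeomorph.symm_apply_apply]

instance DefPred.all {P : X → Y → Prop} [hP : DefPred L K fun p : X × Y => P p.1 p.2] :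
    DefPred L K fun x => ∀ y, P x y :=
  DefPred.congr (P := fun x => ¬ ∃ y, ¬ P x y) inferInstance fun _ => by simp

instance DefPred.all_finite {ι : Type*} [Finite ι] {P : ι → X → Prop}
    [hP : ∀ i, DefPred L K (P i)] : DefPred L K fun x => ∀ i, P i x := by
  refine ⟨?_⟩
  convert! definable_iInter_of_finite fun i => (hP i).out using 1
  ext v
  simp

instance DefPred.ex_finite {ι : Type*} [Finite ι] {P : ι → X → Prop}
    [hP : ∀ i, DefPred L K (P i)] : DefPred L K fun x => ∃ i, P i x :=
  DefPred.congr (P := fun x => ¬ ∀ i, ¬ P i x) inferInstance fun _ => by simp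

/-- Substitution of coordinates: `g` only permutes, repeats and forgets coordinates. -/
theorem DefPred.reindex {P : Y → Prop} (hP : DefPred L K P) (g : X → Y)
    (σ : Coord.Idx K Y → Coord.Idx K X)
    (hg : ∀ x, (Coord.co (g x) : Coord.Idx K Y → K) = Coord.co x ∘ σ) :
    DefPred L K fun x => P (g x) := by
  refine ⟨?_⟩
  convert! hP.out.preimage_comp σ using 1
  ext v
  have h := hg (Coord.co.symm v)
  rw [Homeomorph.apply_symm_apply] at h
  simp [← h]

theorem DefPred.co_eq (i j : Coord.Idx K X) :
    DefPred L K fun x : X => (Coord.co x : Coord.Idx K X → K) i = Coord.co x j := by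
  refine ⟨(FirstOrder.Language.var i).equal (FirstOrder.Language.var j), ?_⟩
  ext v
  simp

theorem DefMap.of_reindex (g : X → Y) (σ : Coord.Idx K Y → Coord.Idx K X)
    (hg : ∀ x, (Coord.co (g x) : Coord.Idx K Y → K) = Coord.co x ∘ σ) : DefMap L K g := by
  have (j : Coord.Idx K Y) := DefPred.co_eq (L := L) (K := K) (X := X × Y)
    (Sum.inl (σ j)) (Sum.inr j)
  refine ⟨DefPred.congr (DefPred.all_finite (hP := this)) fun p => ?_⟩
  rw [← (Coord.co (K := K)).injective.eq_iff, hg, funext_iff]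
  rfl

-- Goals such as `fun x => x ∈ A` may arise eta-reduced; `no_index` keeps the discrimination tree
-- from missing them.
instance DefMap.id : DefMap L K no_index fun x : X => x := .of_reindex _ (fun i => i) fun _ => rfl

theorem DefMap.prodFst : DefMap L K (Prod.fst : X × Y → X) := .of_reindex _ Sum.inl fun _ => rfl

theorem DefMap.prodSnd : DefMap L K (Prod.snd : X × Y → Y) := .of_reindex _ Sum.inr fun _ => rfl

theorem DefMap.proj {ι : Type} [Finite ι] (i : ι) : DefMap L K fun x : ι → K => x i :=
  .of_reindex _ (fun _ => i) fun _ => rfl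

theorem DefMap.precomp {ι κ : Type} [Finite ι] [Finite κ] (σ : κ → ι) :
    DefMap L K fun x : ι → K => x ∘ σ :=
  .of_reindex _ σ fun _ => rfl

theorem DefPred.comp {P : Y → Prop} (hP : DefPred L K P) {f : X → Y} (hf : DefMap L K f) :
    DefPred L K fun x => P (f x) := by
  have h1 := hf.graph
  have h2 : DefPred L K fun p : X × Y => P p.2 := hP.reindex _ Sum.inr fun _ => rfl
  exact DefPred.congr (P := fun x => ∃ y, f x = y ∧ P y) inferInstance fun _ => by simp

theorem DefMap.comp {g : Y → Z} (hg : DefMap L K g) {f : X → Y} (hf : DefMap L K f) :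
    DefMap L K fun x => g (f x) := by
  have h1 : DefPred L K fun p : (X × Z) × Y => f p.1.1 = p.2 :=
    hf.graph.reindex (fun p : (X × Z) × Y => (p.1.1, p.2))
      (Sum.elim (fun i => .inl (.inl i)) .inr) fun _ => by ext (_ | _) <;> rfl
  have h2 : DefPred L K fun p : (X × Z) × Y => g p.2 = p.1.2 :=
    hg.graph.reindex (fun p : (X × Z) × Y => (p.2, p.1.2))
      (Sum.elim .inr fun i => .inl (.inr i)) fun _ => by ext (_ | _) <;> rfl
  exact ⟨DefPred.congr (P := fun p => ∃ y, f p.1 = y ∧ g y = p.2) inferInstance fun _ => by simp⟩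

instance DefMap.fst {f : X → Y × Z} [hf : DefMap L K f] : DefMap L K no_index fun x => (f x).1 :=
  prodFst.comp hf

instance DefMap.snd {f : X → Y × Z} [hf : DefMap L K f] : DefMap L K no_index fun x => (f x).2 :=
  prodSnd.comp hf

instance DefMap.apply {ι : Type} [Finite ι] {f : X → ι → K} (i : ι) [hf : DefMap L K f] :
    DefMap L K fun x => f x i :=
  (proj i).comp hf

instance DefMap.comp_right {ι κ : Type} [Finite ι] [Finite κ] {f : X → ι → K} (σ : κ → ι)
    [hf : DefMap L K f] : DefMap L K fun x => f x ∘ σ :=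
  (precomp σ).comp hf

theorem DefMap.co_apply (i : Coord.Idx K X) :
    DefMap L K fun x : X => (Coord.co x : Coord.Idx K X → K) i :=
  .of_reindex _ (fun _ => i) fun _ => rfl

instance DefMap.coord {f : X → Y} (i : Coord.Idx K Y) [hf : DefMap L K f] :
    DefMap L K fun x => (Coord.co (f x) : Coord.Idx K Y → K) i :=
  (co_apply i).comp hf

theorem DefMap.pair {f : X → Y} {g : X → Z} (hf : DefMap L K f) (hg : DefMap L K g) :
    DefMap L K fun x => (f x, g x) := by
  have h1 : DefPred L K fun p : X × Y × Z => f p.1 = p.2.1 :=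
    hf.graph.reindex (fun p : X × Y × Z => (p.1, p.2.1))
      (Sum.elim .inl fun i => .inr (.inl i)) fun _ => by ext (_ | _) <;> rfl
  have h2 : DefPred L K fun p : X × Y × Z => g p.1 = p.2.2 :=
    hg.graph.reindex (fun p : X × Y × Z => (p.1, p.2.2))
      (Sum.elim .inl fun i => .inr (.inr i)) fun _ => by ext (_ | _) <;> rfl
  exact ⟨DefPred.congr (P := fun p => f p.1 = p.2.1 ∧ g p.1 = p.2.2) inferInstance
    fun _ => by rw [Prod.ext_iff]⟩

theorem DefMap.pi {ι : Type} [Finite ι] {f : X → ι → K} (hf : ∀ i, DefMap L K fun x => f x i) :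
    DefMap L K f := by
  have (i : ι) : DefPred L K fun p : X × (ι → K) => f p.1 i = p.2 i :=
    DefPred.comp (f := fun p : X × (ι → K) => (p.1, p.2 i)) (hf i).graph
      (.pair inferInstance inferInstance)
  exact ⟨DefPred.congr (P := fun p => ∀ i, f p.1 i = p.2 i) inferInstance
    fun _ => funext_iff.symm⟩

instance DefPred.eq {f g : X → Y} [hf : DefMap L K f] [hg : DefMap L K g] :
    DefPred L K no_index fun x => f x = g x :=
  DefPred.comp (f := fun x => (f x, g x)) (DefMap.id (X := Y)).graph (hf.pair hg)

instance DefPred.mem {A : Set Y} {f : X → Y} [hA : DefSet L K A] [hf : DefMap L K f] :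
    DefPred L K no_index fun x => f x ∈ A :=
  hA.mem.comp hf

instance (priority := low) DefPred.mem_pair {A : Set (Y × Z)} {f : X → Y} {g : X → Z}
    [hA : DefSet L K A] [hf : DefMap L K f] [hg : DefMap L K g] :
    DefPred L K no_index fun x => (f x, g x) ∈ A :=
  hA.mem.comp (hf.pair hg)

instance DefPred.mem_fam {F : K → Set Y} {t : X → K} {f : X → Y} [hF : DefFam L K F]
    [hf : DefMap L K f] [ht : DefMap L K t] : DefPred L K no_index fun x => f x ∈ F (t x) :=
  DefPred.comp (f := fun x => (t x, f x)) hF.mem (ht.pair hf)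

instance (priority := low) DefPred.mem_fam_pair {F : K → Set (Y × Z)} {t : X → K} {f : X → Y}
    {g : X → Z} [hF : DefFam L K F] [hf : DefMap L K f] [hg : DefMap L K g] [ht : DefMap L K t] :
    DefPred L K no_index fun x => (f x, g x) ∈ F (t x) :=
  DefPred.comp (f := fun x => (t x, (f x, g x))) hF.mem (ht.pair (hf.pair hg))

instance DefPred.mem_setOf {P : X → Y → Prop} {f : X → Y} [h : DefPred L K fun x => P x (f x)] :
    DefPred L K no_index fun x => f x ∈ {y | P x y} := h

instance DefSet.setOf {P : X → Prop} [h : DefPred L K P] : DefSet L K {x | P x} := ⟨h⟩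

instance DefFam.setOf {P : K → X → Prop} [h : DefPred L K fun p : K × X => P p.1 p.2] :
    DefFam L K fun t => {x | P t x} := ⟨h⟩

theorem DefPred.constK (c : K) : DefPred L K fun x : K => x = c := by
  have := Definable.singleton_of_mem L (mem_univ c)
  exact ⟨this⟩

instance DefMap.const (c : Y) : DefMap L K fun _ : X => c := by
  have (i : Coord.Idx K Y) : DefPred L K fun p : X × Y => (Coord.co p.2 : Coord.Idx K Y → K) i =
      (Coord.co c : Coord.Idx K Y → K) i :=
    (DefPred.constK _).comp (f := fun p : X × Y => (Coord.co p.2 : Coord.Idx K Y → K) i)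
      inferInstance
  refine ⟨DefPred.congr (DefPred.all_finite (hP := this)) fun p => ?_⟩
  rw [← funext_iff, (Coord.co (K := K)).injective.eq_iff, eq_comm]

theorem DefFam.defSet {F : K → Set X} (_ : DefFam L K F) (t : K) : DefSet L K (F t) :=
  ⟨inferInstance⟩

end Rules

/-! ### Agreement with the definitions in coordinates -/

section Conversions

variable {L : FirstOrder.Language.{u, v}} {K : Type w} [L.Structure K] [TopologicalSpace K]

theorem defSet_iff_def {n : ℕ} {A : Set (Fin n → K)} : DefSet L K A ↔ Def L A :=
  ⟨fun h => h.mem.out, fun h => ⟨⟨h⟩⟩⟩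

theorem defSet_iff_def₁ {A : Set K} : DefSet L K A ↔ Def₁ L A :=
  ⟨fun h => h.mem.out, fun h => ⟨⟨h⟩⟩⟩

theorem defPred_iff_definable₂ {P : K × K → Prop} :
    DefPred L K P ↔ (univ : Set K).Definable₂ L {p | P p} := by
  refine ⟨fun h => ?_, fun h => ?_⟩
  · exact h.out.preimage_comp (Sum.elim (fun _ => 0) fun _ => 1)
  · exact ⟨h.preimage_comp ![Sum.inl (0 : Fin 1), Sum.inr (0 : Fin 1)]⟩

theorem defFam_iff_defFamily₁ {F : K → Set K} : DefFam L K F ↔ DefFamily₁ L F :=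
  ⟨fun h => defPred_iff_definable₂.1 h.mem, fun h => ⟨defPred_iff_definable₂.2 h⟩⟩

theorem defFam_iff_defFamily {n : ℕ} {F : K → Set (Fin n → K)} :
    DefFam L K F ↔ DefFamily L F := by
  refine ⟨fun h => ?_, fun h => ⟨⟨?_⟩⟩⟩
  · exact h.mem.out.preimage_comp (Sum.elim (fun _ => 0) Fin.succ)
  · exact h.preimage_comp (Fin.cons (Sum.inl (0 : Fin 1)) Sum.inr)

end Conversions

/-! ### Order, arithmetic and neighbourhoods -/

/-- The standing assumption: a definably complete expansion of an ordered field. -/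
class DefCompleteField (L : FirstOrder.Language.{u, v}) (K : Type w) [L.Structure K] [Field K]
    [LinearOrder K] : Prop where
  exp : ExpandsOrderedField L K
  complete : DefinablyComplete L K

section Arith

variable {L : FirstOrder.Language.{u, v}} {K : Type w} [L.Structure K] [Field K] [LinearOrder K]
  [TopologicalSpace K] [hK : DefCompleteField L K]
variable {X : Type*} [TopologicalSpace X] [Coord K X] {f g : X → K}

instance DefPred.lt [hf : DefMap L K f] [hg : DefMap L K g] :
    DefPred L K no_index fun x => f x < g x := by
  have h : DefPred L K fun p : Fin 2 → K => p 0 < p 1 := ⟨hK.exp.lt⟩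
  exact h.comp (f := fun x => ![f x, g x]) (.pi (by simp [Fin.forall_fin_two, hf, hg]))

instance DefPred.le [hf : DefMap L K f] [hg : DefMap L K g] :
    DefPred L K no_index fun x => f x ≤ g x :=
  DefPred.congr (P := fun x => ¬ g x < f x) inferInstance fun _ => not_lt

instance DefMap.add [hf : DefMap L K f] [hg : DefMap L K g] :
    DefMap L K no_index fun x => f x + g x := by
  have h : DefPred L K fun p : Fin 3 → K => p 0 + p 1 = p 2 := ⟨hK.exp.add⟩
  refine ⟨h.comp (f := fun p : X × K => ![f p.1, g p.1, p.2]) (.pi ?_)⟩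
  simp only [Fin.forall_fin_succ]
  exact ⟨hf.comp inferInstance, hg.comp inferInstance, (inferInstance : DefMap L K Prod.snd),
    fun i => i.elim0⟩

instance DefMap.mul [hf : DefMap L K f] [hg : DefMap L K g] :
    DefMap L K no_index fun x => f x * g x := by
  have h : DefPred L K fun p : Fin 3 → K => p 0 * p 1 = p 2 := ⟨hK.exp.mul⟩
  refine ⟨h.comp (f := fun p : X × K => ![f p.1, g p.1, p.2]) (.pi ?_)⟩
  simp only [Fin.forall_fin_succ]
  exact ⟨hf.comp inferInstance, hg.comp inferInstance, (inferInstance : DefMap L K Prod.snd),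
    fun i => i.elim0⟩

instance DefMap.sub [hf : DefMap L K f] [hg : DefMap L K g] :
    DefMap L K no_index fun x => f x - g x := by
  have hf' : DefMap L K fun p : X × K => f p.1 := hf.comp inferInstance
  have hg' : DefMap L K fun p : X × K => g p.1 := hg.comp inferInstance
  exact ⟨DefPred.congr (P := fun p : X × K => f p.1 = p.2 + g p.1) inferInstance
    fun _ => sub_eq_iff_eq_add.symm⟩

instance DefMap.neg [hf : DefMap L K f] : DefMap L K no_index fun x => - f x := by
  simpa using DefMap.sub (L := L) (f := fun _ : X => (0 : K)) (g := f)

instance DefMap.inv [hf : DefMap L K f] : DefMap L K no_index fun x => (f x)⁻¹ := by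
  have hf' : DefMap L K fun p : X × K => f p.1 := hf.comp inferInstance
  refine ⟨DefPred.congr (P := fun p : X × K => f p.1 * p.2 = 1 ∨ f p.1 = 0 ∧ p.2 = 0)
    inferInstance fun p => ?_⟩
  by_cases h : f p.1 = 0
  · simp [h, eq_comm]
  · simp only [h, false_and, or_false]
    exact mul_eq_one_iff_inv_eq₀ h

variable [IsStrictOrderedRing K]

instance DefMap.abs [hf : DefMap L K f] : DefMap L K no_index fun x => |f x| := by
  have hf' : DefMap L K fun p : X × K => f p.1 := hf.comp inferInstance
  refine ⟨DefPred.congr (P := fun p : X × K => 0 ≤ f p.1 ∧ f p.1 = p.2 ∨ f p.1 < 0 ∧ - f p.1 = p.2)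
    inferInstance fun p => ?_⟩
  rcases le_or_gt 0 (f p.1) with h | h
  · simp [h, abs_of_nonneg, not_lt.2 h]
  · simp [h, abs_of_neg, not_le.2 h]

end Arith

section Near

variable {L : FirstOrder.Language.{u, v}} {K : Type w} [L.Structure K] [Field K] [LinearOrder K]
  [IsStrictOrderedRing K] [TopologicalSpace K]
variable {X Y Z : Type*} [TopologicalSpace X] [Coord K X] [TopologicalSpace Y] [Coord K Y]
  [TopologicalSpace Z] [Coord K Z]

/-- The points `x` and `y` are closer than `ε` in every coordinate. -/
def Near (ε : K) (x y : X) : Prop :=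
  ∀ i : Coord.Idx K X, |(Coord.co x : Coord.Idx K X → K) i - Coord.co y i| < ε

/-- The point `x` lies in the closed box of radius `b` around the origin. -/
def Within (b : K) (x : X) : Prop :=
  ∀ i : Coord.Idx K X, |(Coord.co x : Coord.Idx K X → K) i| ≤ b

instance DefPred.near [DefCompleteField L K] {e : Z → K} {f g : Z → X} [DefMap L K e]
    [DefMap L K f] [DefMap L K g] : DefPred L K no_index fun x => Near (e x) (f x) (g x) := by
  unfold Near; infer_instance

instance DefPred.within [DefCompleteField L K] {e : Z → K} {f : Z → X} [DefMap L K e]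
    [DefMap L K f] : DefPred L K no_index fun x => Within (e x) (f x) := by
  unfold Within; infer_instance

theorem near_self {ε : K} (hε : 0 < ε) (x : X) : Near ε x x := fun i => by simpa using hε

theorem Near.symm {ε : K} {x y : X} (h : Near ε x y) : Near ε y x := fun i => by
  rw [abs_sub_comm]; exact h i

theorem Near.mono {ε δ : K} {x y : X} (h : Near ε x y) (hε : ε ≤ δ) : Near δ x y :=
  fun i => (h i).trans_le hε

theorem Near.trans {ε δ : K} {x y z : X} (h : Near ε x y) (h' : Near δ y z) :
    Near (ε + δ) x z :=
  fun i => (abs_sub_le _ _ _).trans_lt (add_lt_add (h i) (h' i))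

theorem near_iff {ε x y : K} : Near ε x y ↔ |x - y| < ε :=
  ⟨fun h => h (0 : Fin 1), fun h _ => h⟩

theorem near_prod {ε : K} {x y : X × Y} : Near ε x y ↔ Near ε x.1 y.1 ∧ Near ε x.2 y.2 :=
  Sum.forall

theorem near_pi {ι : Type} [Finite ι] {ε : K} {x y : ι → K} :
    Near ε x y ↔ ∀ i, |x i - y i| < ε := Iff.rfl

theorem Within.mono {a b : K} {x : X} (h : Within a x) (hab : a ≤ b) : Within b x :=
  fun i => (h i).trans hab

theorem exists_within (x : X) : ∃ b : K, Within b x := by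
  have := Fintype.ofFinite (Coord.Idx K X)
  refine ⟨∑ i, |(Coord.co x : Coord.Idx K X → K) i|, fun i => ?_⟩
  exact Finset.single_le_sum (f := fun i => |(Coord.co x : Coord.Idx K X → K) i|)
    (fun i _ => abs_nonneg _) (Finset.mem_univ i)

theorem within_iff {b x : K} : Within b x ↔ |x| ≤ b := ⟨fun h => h (0 : Fin 1), fun h _ => h⟩

theorem within_pi {ι : Type} [Finite ι] {b : K} {x : ι → K} : Within b x ↔ ∀ i, |x i| ≤ b :=
  Iff.rfl

variable [OrderTopology K]

omit [TopologicalSpace K] [OrderTopology K] in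
theorem exists_pos_forall_le {ι : Type*} [Finite ι] {e : ι → K} (he : ∀ i, 0 < e i) :
    ∃ ε : K, 0 < ε ∧ ∀ i, ε ≤ e i := by
  cases isEmpty_or_nonempty ι
  · exact ⟨1, one_pos, isEmptyElim⟩
  · obtain ⟨i, hi⟩ := Finite.exists_min e
    exact ⟨e i, he i, hi⟩

theorem nhds_basis_near (x : X) :
    (𝓝 x).HasBasis (fun ε : K => 0 < ε) fun ε => {y | Near ε y x} := by
  have h1 : (𝓝 (Coord.co x : Coord.Idx K X → K)).HasBasis (fun ε : K => 0 < ε)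
      fun ε => {y | ∀ i, |y i - Coord.co x i| < ε} := by
    rw [nhds_pi]
    refine ⟨fun s => ?_⟩
    have h2 := Filter.hasBasis_pi fun i =>
      nhds_basis_abs_sub_lt ((Coord.co x : Coord.Idx K X → K) i)
    rw [h2.mem_iff]
    constructor
    · rintro ⟨⟨I, e⟩, ⟨hI, he⟩, hs⟩
      have := hI.to_subtype
      obtain ⟨ε, hε, hle⟩ := exists_pos_forall_le (e := fun i : I => e i) fun i => he i i.2
      exact ⟨ε, hε, fun y hy => hs fun i hi => (hy i).trans_le (hle ⟨i, hi⟩)⟩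
    · rintro ⟨ε, hε, hs⟩
      exact ⟨(univ, fun _ => ε), ⟨finite_univ, fun _ _ => hε⟩, fun y hy => hs fun i => hy i trivial⟩
  have h3 := h1.comap (Coord.co (K := K) (X := X))
  rwa [← (Coord.co (K := K) (X := X)).isInducing.nhds_eq_comap] at h3

theorem isOpen_iff_near {U : Set X} :
    IsOpen U ↔ ∀ x ∈ U, ∃ ε : K, 0 < ε ∧ ∀ y, Near ε y x → y ∈ U := by
  simp only [isOpen_iff_mem_nhds, (nhds_basis_near (K := K) _).mem_iff]
  rfl

theorem mem_closure_near {A : Set X} {x : X} :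
    x ∈ closure A ↔ ∀ ε : K, 0 < ε → ∃ y ∈ A, Near ε y x := by
  rw [mem_closure_iff_nhds_basis (nhds_basis_near (K := K) x)]
  rfl

theorem mem_interior_near {A : Set X} {x : X} :
    x ∈ interior A ↔ ∃ ε : K, 0 < ε ∧ ∀ y, Near ε y x → y ∈ A := by
  rw [mem_interior_iff_mem_nhds, (nhds_basis_near (K := K) x).mem_iff]
  rfl

theorem continuous_co_apply (i : Coord.Idx K X) :
    Continuous fun x : X => (Coord.co x : Coord.Idx K X → K) i :=
  (continuous_apply i).comp Coord.co.continuous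

theorem isOpen_near (ε : K) (x : X) : IsOpen {y | Near ε y x} := by
  have : {y : X | Near ε y x} = ⋂ i : Coord.Idx K X,
      {y : X | |(Coord.co y : Coord.Idx K X → K) i - Coord.co x i| < ε} := by
    ext; simp [Near]
  rw [this]
  exact isOpen_iInter_of_finite fun i =>
    isOpen_lt ((continuous_co_apply i).sub continuous_const).abs continuous_const

theorem isClosed_within (b : K) : IsClosed {x : X | Within b x} := by
  have : {x : X | Within b x} = ⋂ i : Coord.Idx K X,
      {x : X | |(Coord.co x : Coord.Idx K X → K) i| ≤ b} := by
    ext; simp [Within]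
  rw [this]
  exact isClosed_iInter fun i => isClosed_le (continuous_co_apply i).abs continuous_const

section

variable [DefCompleteField L K]

instance DefSet.closure {A : Set X} [DefSet L K A] : DefSet L K (closure A) :=
  ⟨DefPred.congr (P := fun x : X => ∀ ε : K, 0 < ε → ∃ y ∈ A, Near ε y x) inferInstance
    fun _ => mem_closure_near.symm⟩

instance DefSet.interior {A : Set X} [DefSet L K A] : DefSet L K (interior A) :=
  ⟨DefPred.congr (P := fun x : X => ∃ ε : K, 0 < ε ∧ ∀ y, Near ε y x → y ∈ A) inferInstance
    fun _ => mem_interior_near.symm⟩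

instance DefFam.closure {F : K → Set X} [DefFam L K F] : DefFam L K fun t => closure (F t) :=
  ⟨DefPred.congr (P := fun p : K × X => ∀ ε : K, 0 < ε → ∃ y ∈ F p.1, Near ε y p.2) inferInstance
    fun _ => mem_closure_near.symm⟩

end

theorem isDiscrete_iff_near {S : Set X} :
    IsDiscrete S ↔ ∀ x ∈ S, ∃ ε : K, 0 < ε ∧ ∀ y ∈ S, Near ε y x → y = x := by
  rw [isDiscrete_iff_forall_mem_exists_isOpen]
  refine forall₂_congr fun x hx => ⟨fun ⟨U, hU, h⟩ => ?_, fun ⟨ε, hε, h⟩ => ?_⟩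
  · have hxU : x ∈ U := (h.ge rfl).1
    obtain ⟨ε, hε, h'⟩ := isOpen_iff_near (K := K).1 hU x hxU
    exact ⟨ε, hε, fun y hy hn => h.le ⟨h' y hn, hy⟩⟩
  · refine ⟨_, isOpen_near ε x, Subset.antisymm (fun y hy => h y hy.2 hy.1) ?_⟩
    rintro _ rfl
    exact ⟨near_self hε _, hx⟩

omit [IsStrictOrderedRing K] [OrderTopology K] in
theorem eq_of_forall_near [IsStrictOrderedRing K] {x y : X}
    (h : ∀ ε : K, 0 < ε → Near ε x y) : x = y := by
  refine (Coord.co (K := K)).injective (funext fun i => ?_)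
  by_contra hne
  exact lt_irrefl _ (h _ (abs_pos.2 (sub_ne_zero.2 hne)) i)

/-- Closed discrete sets are the sets without accumulation points. -/
theorem isClosed_and_isDiscrete_iff_near {S : Set X} :
    IsClosed S ∧ IsDiscrete S ↔ ∀ x, ∃ ε : K, 0 < ε ∧ ∀ y ∈ S, Near ε y x → y = x := by
  constructor
  · rintro ⟨hc, hd⟩ x
    by_cases hx : x ∈ S
    · exact isDiscrete_iff_near.1 hd x hx
    · obtain ⟨ε, hε, h⟩ := isOpen_iff_near (K := K).1 hc.isOpen_compl x hx
      exact ⟨ε, hε, fun y hy hn => (h y hn hy).elim⟩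
  · refine fun h => ⟨⟨isOpen_iff_near (K := K).2 fun x hx => ?_⟩,
      isDiscrete_iff_near (K := K).2 fun x _ => h x⟩
    obtain ⟨ε, hε, h⟩ := h x
    exact ⟨ε, hε, fun y hn hy => hx (h y hy hn ▸ hy)⟩

/-- Closed, bounded and discrete subsets of a space with coordinates in `K`. -/
structure PFin (K : Type w) [Field K] [LinearOrder K] [TopologicalSpace K] {X : Type*}
    [TopologicalSpace X] [Coord K X] (S : Set X) : Prop where
  isClosed : IsClosed S
  bounded : ∃ b : K, ∀ x ∈ S, Within b x
  isDiscrete : IsDiscrete S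

theorem PFin.mono {S T : Set X} (hT : PFin K T) (h : S ⊆ T) : PFin K S where
  isClosed := isClosed_of_subset_discrete_closed h hT.isDiscrete hT.isClosed
  bounded := hT.bounded.imp fun _ hb x hx => hb x (h hx)
  isDiscrete := hT.isDiscrete.mono h

theorem pFin_iff {S : Set K} : PFin K S ↔ PseudoFinite S := by
  have : (∃ b : K, ∀ x ∈ S, Within b x) ↔ BddBelow S ∧ BddAbove S := by
    simp only [within_iff, abs_le]
    refine ⟨fun ⟨b, h⟩ => ⟨⟨-b, fun x hx => (h x hx).1⟩, ⟨b, fun x hx => (h x hx).2⟩⟩, ?_⟩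
    rintro ⟨⟨a, ha⟩, ⟨b, hb⟩⟩
    exact ⟨max (-a) b, fun x hx => ⟨by linarith [ha hx, le_max_left (-a) b],
      (hb hx).trans (le_max_right _ _)⟩⟩
  exact ⟨fun h => ⟨h.1, this.1 h.2, h.3⟩, fun h => ⟨h.1, this.2 h.2.1, h.2.2⟩⟩

theorem pFin_pi_iff {ι : Type} [Finite ι] {S : Set (ι → K)} : PFin K S ↔ PseudoFinite S := by
  have : (∃ b : K, ∀ x ∈ S, Within b x) ↔ BddBelow S ∧ BddAbove S := by
    simp only [within_pi, abs_le]
    refine ⟨fun ⟨b, h⟩ => ⟨⟨fun _ => -b, fun x hx i => (h x hx i).1⟩,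
      ⟨fun _ => b, fun x hx i => (h x hx i).2⟩⟩, ?_⟩
    rintro ⟨⟨a, ha⟩, ⟨b, hb⟩⟩
    obtain ⟨c, hc⟩ := exists_within (K := K) a
    obtain ⟨d, hd⟩ := exists_within (K := K) b
    refine ⟨max c d, fun x hx i => ⟨?_, ?_⟩⟩
    · linarith [ha hx i, (abs_le.1 (within_pi.1 hc i)).1, le_max_left c d]
    · linarith [hb hx i, (abs_le.1 (within_pi.1 hd i)).2, le_max_right c d]
  exact ⟨fun h => ⟨h.1, this.1 h.2, h.3⟩, fun h => ⟨h.1, this.2 h.2.1, h.2.2⟩⟩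

end Near

/-! ### Definable compactness -/

section Compact

variable (L : FirstOrder.Language.{u, v}) {K : Type w} [L.Structure K] [Field K] [LinearOrder K]
  [IsStrictOrderedRing K] [TopologicalSpace K] [OrderTopology K] [hK : DefCompleteField L K]
variable {X Y Z : Type*} [TopologicalSpace X] [Coord K X] [TopologicalSpace Y] [Coord K Y]
  [TopologicalSpace Z] [Coord K Z]

theorem exists_isLUB_of_defSet (A : Set K) [hA : DefSet L K A] (hne : A.Nonempty)
    (hb : BddAbove A) : ∃ a, IsLUB A a :=
  hK.complete A (defSet_iff_def₁.1 hA) hne hb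

/-- A bounded definable family of nonempty sets, shrinking as `ε > 0` decreases, has a cluster
point. The coordinates of the point are found one after the other: each is the limit of the
infima of that coordinate over the part of the family that clusters in the earlier ones. -/
theorem exists_cluster (C : K → Set X) [DefFam L K C] (hne : ∀ ε, 0 < ε → (C ε).Nonempty)
    (hmono : ∀ ε δ, 0 < ε → ε ≤ δ → C ε ⊆ C δ) {b : K}
    (hb : ∀ ε, 0 < ε → ∀ x ∈ C ε, Within b x) :
    ∃ s : X, ∀ ε : K, 0 < ε → ∃ x ∈ C ε, Near ε x s := by
  have key (F : Finset (Coord.Idx K X)) : ∃ s : Coord.Idx K X → K, ∀ ε : K, 0 < ε → ∃ x ∈ C ε,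
      ∀ i ∈ F, |(Coord.co x : Coord.Idx K X → K) i - s i| < ε := by
    classical
    induction F using Finset.induction_on with
    | empty => exact ⟨fun _ => 0, fun ε hε => (hne ε hε).imp fun x hx => ⟨hx, by simp⟩⟩
    | insert j F hj ih =>
      obtain ⟨s, hs⟩ := ih
      let A : Set K := {c | ∃ ε : K, 0 < ε ∧ ∀ x, x ∈ C ε →
        (∀ i, i ∈ F → |(Coord.co x : Coord.Idx K X → K) i - s i| < ε) →
          c ≤ (Coord.co x : Coord.Idx K X → K) j}
      have hA : DefSet L K A := inferInstance
      have hA0 : -b ∈ A := ⟨1, one_pos, fun x hx _ => (abs_le.1 (hb 1 one_pos x hx j)).1⟩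
      have hAb : BddAbove A := by
        refine ⟨b, ?_⟩
        rintro c ⟨ε, hε, hc⟩
        obtain ⟨x, hx, hxs⟩ := hs ε hε
        exact (hc x hx hxs).trans (abs_le.1 (hb ε hε x hx j)).2
      obtain ⟨a, ha⟩ := exists_isLUB_of_defSet L A ⟨_, hA0⟩ hAb
      refine ⟨Function.update s j a, fun ε hε => ?_⟩
      obtain ⟨c, ⟨δ, hδ, hc⟩, hac, -⟩ := ha.exists_between (sub_lt_self a hε)
      have hn : a + ε ∉ A := fun h => absurd (ha.1 h) (by simp [hε])
      have : ¬ ∀ x, x ∈ C (min ε δ) →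
          (∀ i, i ∈ F → |(Coord.co x : Coord.Idx K X → K) i - s i| < min ε δ) →
          a + ε ≤ (Coord.co x : Coord.Idx K X → K) j := fun h => hn ⟨_, lt_min hε hδ, h⟩
      push Not at this
      obtain ⟨x, hx, hxs, hxj⟩ := this
      refine ⟨x, hmono _ _ (lt_min hε hδ) (min_le_left _ _) hx, fun i hi => ?_⟩
      rcases eq_or_ne i j with rfl | hij
      · have := hc x (hmono _ _ (lt_min hε hδ) (min_le_right _ _) hx)
          fun i hi => (hxs i hi).trans_le (min_le_right _ _)
        rw [Function.update_self, abs_lt]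
        constructor <;> linarith
      · rw [Function.update_of_ne hij]
        exact (hxs i (Finset.mem_of_mem_insert_of_ne hi hij)).trans_le (min_le_left _ _)
  have := Fintype.ofFinite (Coord.Idx K X)
  obtain ⟨s, hs⟩ := key Finset.univ
  refine ⟨Coord.co.symm s, fun ε hε => (hs ε hε).imp fun x hx => ⟨hx.1, fun i => ?_⟩⟩
  rw [Homeomorph.apply_symm_apply]
  exact hx.2 i (Finset.mem_univ i)

theorem isClosed_image_of_bounded {f : X → Y} (hfd : DefMap L K f) (hf : Continuous f) {C : Set X}
    [DefSet L K C] (hC : IsClosed C) {b : K} (hb : ∀ x ∈ C, Within b x) : IsClosed (f '' C) := by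
  refine isClosed_of_closure_subset fun y hy => ?_
  have hfd' : DefMap L K fun p : K × X => f p.2 := hfd.comp inferInstance
  have hy' := mem_closure_near (K := K).1 hy
  obtain ⟨s, hs⟩ := exists_cluster L (fun ε : K => {x | x ∈ C ∧ Near ε (f x) y})
    (fun ε hε => by obtain ⟨_, ⟨x, hx, rfl⟩, h⟩ := hy' ε hε; exact ⟨x, hx, h⟩)
    (fun ε δ _ h x hx => ⟨hx.1, hx.2.mono h⟩) (b := b) (fun ε _ x hx => hb x hx.1)
  have hsC : s ∈ C := hC.closure_subset <| mem_closure_near (K := K).2 fun ε hε =>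
    (hs ε hε).imp fun x hx => ⟨hx.1.1, hx.2⟩
  refine ⟨s, hsC, eq_of_forall_near (K := K) fun δ hδ => ?_⟩
  obtain ⟨η, hη, h⟩ := ((nhds_basis_near (K := K) s).tendsto_iff (nhds_basis_near (K := K) (f s))).1
    (hf.tendsto s) (δ / 2) (half_pos hδ)
  obtain ⟨x, hx, hxs⟩ := hs (min η (δ / 2)) (lt_min hη (half_pos hδ))
  have h1 : Near (δ / 2) (f x) (f s) := h x (hxs.mono (min_le_left _ _))
  have h2 := h1.symm.trans (hx.2.mono (min_le_right _ _))
  rwa [add_halves] at h2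

/-- Pseudo-finite sets are compact in the strong sense that a shrinking definable family of
nonempty subsets, closed or not, has a common point. -/
theorem PFin.exists_forall_mem {S : Set X} (hS : PFin K S) (C : K → Set X) [DefFam L K C]
    (hne : ∀ ε, 0 < ε → (C ε).Nonempty) (hmono : ∀ ε δ, 0 < ε → ε ≤ δ → C ε ⊆ C δ)
    (hsub : ∀ ε, 0 < ε → C ε ⊆ S) : ∃ x, ∀ ε : K, 0 < ε → x ∈ C ε := by
  obtain ⟨b, hb⟩ := hS.bounded
  obtain ⟨s, hs⟩ := exists_cluster L C hne hmono fun ε hε x hx => hb x (hsub ε hε hx)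
  obtain ⟨ε₀, hε₀, h⟩ := isClosed_and_isDiscrete_iff_near (K := K).1 ⟨hS.isClosed, hS.isDiscrete⟩ s
  refine ⟨s, fun ε hε => ?_⟩
  have hm := lt_min hε hε₀
  obtain ⟨x, hx, hxs⟩ := hs _ hm
  obtain rfl := h x (hsub _ hm hx) (hxs.mono (min_le_right _ _))
  exact hmono _ _ hm (min_le_left _ _) hx

/-! ### Consequences of pseudo-finiteness of closed discrete subsets of the line -/

variable (K) in
/-- Every definable closed discrete subset of `K` is pseudo-finite. -/
def DiscretePFin : Prop :=
  ∀ D : Set K, DefSet L K D → IsDiscrete D → IsClosed D → PFin K D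

variable {L}

/-- Consider the parameters at which some point enters the increasing family. Locally they come
from a single member of the family, so they do not accumulate; hence they are bounded, and the
family is constant from some parameter on. -/
theorem DiscretePFin.exists_iUnion_eq (hT : DiscretePFin L K) {F : K → Set X} (hF : DefFam L K F)
    (hmono : Monotone F) (hfin : ∀ t, PFin K (F t)) : ∃ T, ⋃ t, F t = F T := by
  let J : Set K := {s | ∃ x, (∀ t, s < t → x ∈ F t) ∧ ∀ t, t < s → x ∉ F t}
  have hJ : IsClosed J ∧ IsDiscrete J := by
    refine isClosed_and_isDiscrete_iff_near (K := K).2 fun y => ?_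
    by_contra! hacc
    obtain ⟨x, hx⟩ := (hfin (y + 1)).exists_forall_mem L
      (fun ε : K => {x | x ∈ F (y + 1) ∧ ∃ s, s ≠ y ∧ Near ε s y ∧
        (∀ t, s < t → x ∈ F t) ∧ ∀ t, t < s → x ∉ F t})
      (fun ε hε => by
        obtain ⟨s, ⟨x, hx⟩, hs, hsy⟩ := hacc (min ε 1) (lt_min hε one_pos)
        have : s < y + 1 := by
          have := (abs_lt.1 (near_iff.1 (hs.mono (min_le_right _ _)))).2
          linarith
        exact ⟨x, hx.1 _ this, s, hsy, hs.mono (min_le_left _ _), hx⟩)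
      (fun ε δ _ h x hx => ⟨hx.1, by
        obtain ⟨s, h1, h2, h3⟩ := hx.2
        exact ⟨s, h1, h2.mono h, h3⟩⟩)
      (fun ε _ x hx => hx.1)
    obtain ⟨-, s, hsy, -, h1, h2⟩ := hx 1 one_pos
    obtain ⟨-, s', -, hs', h1', h2'⟩ := hx |s - y| (abs_pos.2 (sub_ne_zero.2 hsy))
    obtain rfl : s = s' := by
      rcases lt_trichotomy s s' with h | h | h
      · obtain ⟨t, ht, ht'⟩ := exists_between h
        exact (h2' t ht' (h1 t ht)).elim
      · exact h
      · obtain ⟨t, ht, ht'⟩ := exists_between h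
        exact (h2 t ht' (h1' t ht)).elim
    exact lt_irrefl _ (near_iff.1 hs')
  obtain ⟨T, hTJ⟩ := (hT J inferInstance hJ.2 hJ.1).bounded
  refine ⟨T + 1, Subset.antisymm (iUnion_subset fun t x hx => ?_) (subset_iUnion _ _)⟩
  by_contra hxT
  have hlb : ∀ t, x ∈ F t → T + 1 ≤ t := fun t ht => by
    by_contra! h
    exact hxT (hmono h.le ht)
  -- the supremum of the parameters before which `x` has not entered
  obtain ⟨s, hs⟩ := exists_isLUB_of_defSet L {t | x ∉ F t} ⟨T + 1, hxT⟩
    ⟨t, fun t' ht' => by by_contra! h; exact ht' (hmono h.le hx)⟩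
  have hsJ : s ∈ J := by
    refine ⟨x, fun t ht => ?_, fun t ht htx => ?_⟩
    · by_contra h
      exact absurd (hs.1 h) (not_le.2 ht)
    · refine absurd (hs.2 (fun t' ht' => ?_)) (not_le.2 ht)
      by_contra! h
      exact ht' (hmono h.le htx)
  have h1 := hs.1 hxT
  have h2 := (abs_le.1 (within_iff.1 (hTJ s hsJ))).2
  linarith

theorem DiscretePFin.iUnion (hT : DiscretePFin L K) {F : K → Set X} (hF : DefFam L K F)
    (hmono : Monotone F) (hfin : ∀ t, PFin K (F t)) : PFin K (⋃ t, F t) := by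
  obtain ⟨T, h⟩ := hT.exists_iUnion_eq hF hmono hfin
  exact h ▸ hfin T

/-- If the points of a set keep a distance, the set is closed and discrete. -/
theorem isClosed_and_isDiscrete_of_separated {S : Set X} {ε : K} (hε : 0 < ε)
    (h : ∀ x ∈ S, ∀ y ∈ S, Near ε x y → x = y) : IsClosed S ∧ IsDiscrete S := by
  refine isClosed_and_isDiscrete_iff_near (K := K).2 fun x => ?_
  by_cases hx : ∃ y ∈ S, Near (ε / 2) y x ∧ y ≠ x
  · obtain ⟨y, hyS, hyx, hne⟩ := hx
    by_contra! hacc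
    -- two points of `S` close to `x`: the second avoids the first
    have : ∃ δ : K, 0 < δ ∧ δ ≤ ε / 2 ∧ ¬ Near δ y x := by
      by_contra! hall
      refine hne (eq_of_forall_near (K := K) fun δ hδ => ?_)
      exact (hall _ (lt_min hδ (half_pos hε)) (min_le_right _ _)).mono (min_le_left _ _)
    obtain ⟨δ, hδ, hδε, hn⟩ := this
    obtain ⟨z, hzS, hzx, -⟩ := hacc δ hδ
    have hyz := hyx.trans (hzx.mono hδε).symm
    rw [add_halves] at hyz
    exact hn (h y hyS z hzS hyz ▸ hzx)
  · push Not at hx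
    exact ⟨ε / 2, half_pos hε, hx⟩

/-- In a closed nowhere dense set accumulating at `p`, the gaps near `p` would get arbitrarily
short, but for each `ε` there are only pseudo-finitely many gaps longer than `ε`; so the inverses
of the lengths of the gaps would form a closed discrete unbounded set. -/
theorem DiscretePFin.of_isNowhereDense (hT : DiscretePFin L K) {A : Set K} [DefSet L K A]
    (hA : IsNowhereDense A) : PFin K A := by
  suffices h : ∀ B : Set K, DefSet L K B → IsClosed B → interior B = ∅ →
      IsClosed B ∧ IsDiscrete B by
    have hB := h (closure A) inferInstance isClosed_closure hA
    exact (hT _ inferInstance hB.2 hB.1).mono subset_closure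
  intro B _ hBc hBi
  refine isClosed_and_isDiscrete_iff_near (K := K).2 fun p => ?_
  by_contra! hacc
  let G : Set (K × K) := {q | q.1 ∈ B ∧ q.2 ∈ B ∧ q.1 < q.2 ∧ (∀ r, q.1 < r → r < q.2 → r ∉ B) ∧
    p - 1 ≤ q.1 ∧ q.2 ≤ p + 1}
  have hG : DefSet L K G := inferInstance
  have hGe {a b c : K} (h1 : (a, b) ∈ G) (h2 : (a, c) ∈ G) : b = c := by
    rcases lt_trichotomy b c with h | h | h
    · exact (h2.2.2.2.1 b h1.2.2.1 h h1.2.1).elim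
    · exact h
    · exact (h1.2.2.2.1 c h2.2.2.1 h h2.2.1).elim
  -- the left end points of the gaps longer than `ε`
  have hE (ε : K) (hε : 0 < ε) : PFin K {a | ∃ b, (a, b) ∈ G ∧ a + ε ≤ b} := by
    have hsep := isClosed_and_isDiscrete_of_separated (K := K)
      (S := {a : K | ∃ b, (a, b) ∈ G ∧ a + ε ≤ b}) hε fun a ⟨b, hb, hab⟩ a' ⟨b', hb', hab'⟩ hn => by
        have hn := abs_lt.1 (near_iff.1 hn)
        rcases lt_trichotomy a a' with h | h | h
        · exact (hb.2.2.2.1 a' h (by dsimp only; linarith) hb'.1).elim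
        · exact h
        · exact (hb'.2.2.2.1 a h (by dsimp only; linarith) hb.1).elim
    exact hT _ inferInstance hsep.2 hsep.1
  let Λ : Set K := {l | ∃ a b, (a, b) ∈ G ∧ l * (b - a) = 1}
  have hΛ : IsClosed Λ ∧ IsDiscrete Λ := by
    refine isClosed_and_isDiscrete_iff_near (K := K).2 fun y => ?_
    by_contra! hy
    obtain ⟨a, ha⟩ := (hE (|y| + 1)⁻¹ (by positivity)).exists_forall_mem L
      (fun δ : K => {a | (∃ b, (a, b) ∈ G ∧ a + (|y| + 1)⁻¹ ≤ b) ∧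
        ∃ l, l ≠ y ∧ Near δ l y ∧ ∃ b, (a, b) ∈ G ∧ l * (b - a) = 1})
      (fun δ hδ => by
        obtain ⟨l, ⟨a, b, hab, hl⟩, hly, hne⟩ := hy (min δ 1) (lt_min hδ one_pos)
        refine ⟨a, ⟨b, hab, ?_⟩, l, hne, hly.mono (min_le_left _ _), b, hab, hl⟩
        have h1 : 0 < b - a := sub_pos.2 hab.2.2.1
        have h2 := (abs_lt.1 (near_iff.1 (hly.mono (min_le_right _ _)))).2
        have h3 : (|y| + 1)⁻¹ ≤ b - a := by
          rw [inv_le_iff_one_le_mul₀ (by positivity), ← hl, mul_comm]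
          exact mul_le_mul_of_nonneg_left (by linarith [le_abs_self y]) h1.le
        linarith)
      (fun δ η _ h a ha => ⟨ha.1, by
        obtain ⟨l, h1, h2, h3⟩ := ha.2
        exact ⟨l, h1, h2.mono h, h3⟩⟩)
      (fun δ _ a ha => ha.1)
    obtain ⟨-, l, hly, -, b, hab, hl⟩ := ha 1 one_pos
    obtain ⟨-, l', -, hn, b', hab', hl'⟩ := ha |l - y| (abs_pos.2 (sub_ne_zero.2 hly))
    obtain rfl := hGe hab hab'
    have : l = l' := mul_right_cancel₀ (sub_ne_zero.2 hab.2.2.1.ne') (hl.trans hl'.symm)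
    exact lt_irrefl _ (near_iff.1 (this ▸ hn))
  obtain ⟨M, hM⟩ := (hT Λ inferInstance hΛ.2 hΛ.1).bounded
  have hM' {a b : K} (h : (a, b) ∈ G) : 1 ≤ M * (b - a) := by
    have h1 : 0 < b - a := sub_pos.2 h.2.2.1
    have h2 := within_iff.1 (hM (b - a)⁻¹ ⟨a, b, h, inv_mul_cancel₀ h1.ne'⟩)
    calc 1 = (b - a)⁻¹ * (b - a) := (inv_mul_cancel₀ h1.ne').symm
      _ ≤ M * (b - a) := mul_le_mul_of_nonneg_right ((le_abs_self _).trans h2) h1.le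
  -- a gap inside a prescribed interval near `p`
  have hgap {u v : K} (hu : u ∈ B) (hv : v ∈ B) (huv : u < v) (hup : p - 1 ≤ u)
      (hvp : v ≤ p + 1) : ∃ a b, (a, b) ∈ G ∧ b - a ≤ v - u := by
    obtain ⟨r, hr, hrB⟩ : ∃ r ∈ Ioo u v, r ∉ B := by
      by_contra! h
      have : Ioo u v ⊆ interior B := interior_maximal h isOpen_Ioo
      rw [hBi] at this
      exact (nonempty_Ioo.2 huv).ne_empty (subset_empty_iff.1 this)
    obtain ⟨a, ha⟩ := exists_isLUB_of_defSet L {x | x ∈ B ∧ x ≤ r} ⟨u, hu, hr.1.le⟩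
      ⟨r, fun x hx => hx.2⟩
    obtain ⟨b, hb⟩ := exists_isLUB_of_defSet L {x | -x ∈ B ∧ r ≤ -x} ⟨-v, by simpa using hv,
      by simpa using hr.2.le⟩ ⟨-r, fun x hx => le_neg.1 hx.2⟩
    have haB : a ∈ B := hBc.closure_subset_iff.2 (fun x hx => hx.1)
      (ha.mem_closure ⟨u, hu, hr.1.le⟩)
    have hbB : -b ∈ B := by
      have hc : IsClosed {x : K | -x ∈ B} := hBc.preimage continuous_neg
      exact hc.closure_subset_iff.2 (fun x hx => hx.1)
        (hb.mem_closure ⟨-v, by simpa using hv, by simpa using hr.2.le⟩)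
    have har : a ≤ r := ha.2 fun x hx => hx.2
    have hrb : r ≤ -b := le_neg.1 (hb.2 fun x hx => le_neg.1 hx.2)
    have hua : u ≤ a := ha.1 ⟨hu, hr.1.le⟩
    have hbv : -b ≤ v := neg_le.1 (hb.1 ⟨by simpa using hv, by simpa using hr.2.le⟩)
    have har' : a < r := lt_of_le_of_ne har fun h => hrB (h ▸ haB)
    refine ⟨a, -b, ⟨haB, hbB, har'.trans_le hrb, fun x hax hxb hxB => ?_, by dsimp only; linarith,
      by dsimp only; linarith⟩, by linarith⟩
    rcases le_total x r with h | h
    · exact absurd (ha.1 ⟨hxB, h⟩) (not_le.2 hax)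
    · have := hb.1 (show -x ∈ {x : K | -x ∈ B ∧ r ≤ -x} from ⟨by simpa using hxB, by simpa using h⟩)
      dsimp only at hxb
      linarith
  have hpB : p ∈ B := hBc.closure_subset_iff.2 Subset.rfl <| mem_closure_near (K := K).2
    fun ε hε => (hacc ε hε).imp fun x hx => ⟨hx.1, hx.2.1⟩
  obtain ⟨q, hqB, hqp, hne⟩ := hacc (min 1 (|M| + 1)⁻¹) (lt_min one_pos (by positivity))
  have hq1 := abs_lt.1 (near_iff.1 (hqp.mono (min_le_left _ _)))
  have hq2 := near_iff.1 (hqp.mono (min_le_right _ _))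
  obtain ⟨a, b, hab, hle⟩ : ∃ a b, (a, b) ∈ G ∧ b - a ≤ |q - p| := by
    rcases lt_or_gt_of_ne hne with h | h
    · rw [abs_of_neg (sub_neg.2 h), neg_sub]
      exact hgap hqB hpB h (by linarith) (by linarith)
    · rw [abs_of_pos (sub_pos.2 h)]
      exact hgap hpB hqB h (by linarith) (by linarith)
  have h1 : 0 < b - a := sub_pos.2 hab.2.2.1
  have h2 : (|M| + 1) * (b - a) < 1 := by
    calc (|M| + 1) * (b - a) < (|M| + 1) * (|M| + 1)⁻¹ :=
          mul_lt_mul_of_pos_left (hle.trans_lt hq2) (by positivity)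
      _ = 1 := mul_inv_cancel₀ (by positivity)
  have h3 : M * (b - a) ≤ (|M| + 1) * (b - a) :=
    mul_le_mul_of_nonneg_right (by linarith [le_abs_self M]) h1.le
  linarith [hM' hab]

end Compact

/-! ### Definable `F_σ` sets -/

section FSigma

variable (L : FirstOrder.Language.{u, v}) {K : Type w} [L.Structure K] [Field K] [LinearOrder K]
  [IsStrictOrderedRing K] [TopologicalSpace K] [OrderTopology K] [hK : DefCompleteField L K]
variable {X Y Z : Type*} [TopologicalSpace X] [Coord K X] [TopologicalSpace Y] [Coord K Y]
  [TopologicalSpace Z] [Coord K Z]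

variable (K) in
/-- The union of a definable increasing family of closed sets. -/
def FSig (A : Set X) : Prop :=
  ∃ F : K → Set X, DefFam L K F ∧ Monotone F ∧ (∀ t, IsClosed (F t)) ∧ A = ⋃ t, F t

variable {L}

theorem DefFam.iUnion {F : K → Set X} (hF : DefFam L K F) : DefSet L K (⋃ t, F t) :=
  ⟨DefPred.congr (P := fun x => ∃ t, x ∈ F t) inferInstance fun _ => mem_iUnion.symm⟩

theorem FSig.defSet {A : Set X} (hA : FSig L K A) : DefSet L K A := by
  obtain ⟨F, hF, -, -, rfl⟩ := hA
  exact hF.iUnion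

theorem FSig.of_isClosed {A : Set X} [DefSet L K A] (hA : IsClosed A) : FSig L K A :=
  ⟨fun _ => A, ⟨inferInstance⟩, monotone_const, fun _ => hA, (iUnion_const A).symm⟩

theorem FSig.of_isOpen {A : Set X} [DefSet L K A] (hA : IsOpen A) : FSig L K A := by
  refine ⟨fun t => {x | 0 < t ∧ ∀ y, Near t⁻¹ y x → y ∈ A}, inferInstance,
    fun s t hst x hx => ⟨hx.1.trans_le hst, fun y hy => hx.2 y (hy.mono ?_)⟩, fun t => ?_, ?_⟩
  · exact inv_anti₀ hx.1 hst
  · rcases le_or_gt t 0 with ht | ht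
    · simp [not_lt.2 ht]
    · have : {x | 0 < t ∧ ∀ y, Near t⁻¹ y x → y ∈ A} = (⋃ y ∈ Aᶜ, {x | Near t⁻¹ x y})ᶜ := by
        ext x
        simp only [ht, true_and, mem_ofPred_eq, mem_compl_iff, mem_iUnion, not_exists]
        exact ⟨fun h y hy hn => hy (h y hn.symm), fun h y hn => by_contra fun hy => h y hy hn.symm⟩
      dsimp only
      rw [this]
      exact (isOpen_biUnion fun y _ => isOpen_near _ y).isClosed_compl
  · ext x
    simp only [mem_iUnion, mem_ofPred_eq]
    refine ⟨fun hx => ?_, fun ⟨t, ht, h⟩ => h x (near_self (inv_pos.2 ht) x)⟩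
    obtain ⟨ε, hε, h⟩ := isOpen_iff_near (K := K).1 hA x hx
    exact ⟨ε⁻¹, inv_pos.2 hε, by simpa using h⟩

theorem FSig.union {A B : Set X} (hA : FSig L K A) (hB : FSig L K B) : FSig L K (A ∪ B) := by
  obtain ⟨F, hF, hFm, hFc, rfl⟩ := hA
  obtain ⟨G, hG, hGm, hGc, rfl⟩ := hB
  refine ⟨fun t => F t ∪ G t, ?_, fun s t h => union_subset_union (hFm h) (hGm h),
    fun t => (hFc t).union (hGc t), by rw [iUnion_union_distrib]⟩
  exact ⟨DefPred.congr (P := fun p : K × X => p.2 ∈ F p.1 ∨ p.2 ∈ G p.1) inferInstance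
    fun _ => Iff.rfl⟩

theorem FSig.inter {A B : Set X} (hA : FSig L K A) (hB : FSig L K B) : FSig L K (A ∩ B) := by
  obtain ⟨F, hF, hFm, hFc, rfl⟩ := hA
  obtain ⟨G, hG, hGm, hGc, rfl⟩ := hB
  refine ⟨fun t => F t ∩ G t, ?_, fun s t h => inter_subset_inter (hFm h) (hGm h),
    fun t => (hFc t).inter (hGc t), (iUnion_inter_of_monotone hFm hGm).symm⟩
  exact ⟨DefPred.congr (P := fun p : K × X => p.2 ∈ F p.1 ∧ p.2 ∈ G p.1) inferInstance
    fun _ => Iff.rfl⟩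

theorem FSig.preimage {A : Set Y} (hA : FSig L K A) {f : X → Y} (hfd : DefMap L K f)
    (hf : Continuous f) : FSig L K (f ⁻¹' A) := by
  obtain ⟨F, hF, hFm, hFc, rfl⟩ := hA
  have hfd' : DefMap L K fun p : K × X => f p.2 := hfd.comp inferInstance
  refine ⟨fun t => f ⁻¹' F t, ?_, fun s t h => preimage_mono (hFm h),
    fun t => (hFc t).preimage hf, preimage_iUnion⟩
  exact ⟨DefPred.congr (P := fun p : K × X => f p.2 ∈ F p.1) inferInstance fun _ => Iff.rfl⟩

/-- The closed sets may be taken bounded, and then their images are closed. -/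
theorem FSig.image {A : Set X} (hA : FSig L K A) {f : X → Y} (hfd : DefMap L K f)
    (hf : Continuous f) : FSig L K (f '' A) := by
  obtain ⟨F, hF, hFm, hFc, rfl⟩ := hA
  have hfd' : DefMap L K fun p : (K × Y) × X => f p.2 := hfd.comp inferInstance
  refine ⟨fun t => {y | ∃ x, (x ∈ F t ∧ Within t x) ∧ f x = y}, inferInstance, ?_, fun t => ?_, ?_⟩
  · rintro s t h y ⟨x, hx, rfl⟩
    exact ⟨x, ⟨hFm h hx.1, hx.2.mono h⟩, rfl⟩
  · have h1 := hF.defSet t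
    exact isClosed_image_of_bounded L (C := {x | x ∈ F t ∧ Within t x}) hfd hf
      ((hFc t).inter (isClosed_within t)) (b := t) fun x hx => hx.2
  · ext y
    simp only [mem_image, mem_iUnion, mem_ofPred_eq]
    constructor
    · rintro ⟨x, ⟨t, ht⟩, rfl⟩
      obtain ⟨b, hb⟩ := exists_within (K := K) x
      exact ⟨max t b, x, ⟨hFm (le_max_left _ _) ht, hb.mono (le_max_right _ _)⟩, rfl⟩
    · rintro ⟨t, x, ⟨ht, -⟩, rfl⟩
      exact ⟨x, ⟨t, ht⟩, rfl⟩

/-! ### Meager sets are nowhere dense -/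

omit [TopologicalSpace K] [OrderTopology K] [Coord K X] in
theorem isNowhereDense_union {X : Type*} [TopologicalSpace X] {A B : Set X}
    (hA : IsNowhereDense A) (hB : IsNowhereDense B) : IsNowhereDense (A ∪ B) := by
  rw [IsNowhereDense, closure_union,
    interior_union_isClosed_of_interior_empty isClosed_closure hB]
  exact hA

theorem isNowhereDense_iff_near {A : Set X} : IsNowhereDense A ↔ ∀ x, ∀ ε : K, 0 < ε →
    ∃ y, Near ε y x ∧ ∃ δ : K, 0 < δ ∧ ∀ z, Near δ z y → z ∉ A := by
  rw [IsNowhereDense, eq_empty_iff_forall_notMem]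
  simp only [mem_interior_near (K := K), mem_closure_near (K := K)]
  push Not
  refine forall_congr' fun x => forall₂_congr fun ε _ => exists_congr fun y => and_congr_right
    fun _ => exists_congr fun δ => and_congr_right fun _ => forall_congr' fun z => ?_
  exact ⟨fun h h1 h2 => h h2 h1, fun h h1 h2 => h h2 h1⟩

theorem defPred_isNowhereDense {F : K → Set X} (hF : DefFam L K F) :
    DefPred L K fun t => IsNowhereDense (F t) := by
  have : DefPred L K fun t => ∀ x, ∀ ε : K, 0 < ε →
    ∃ y, Near ε y x ∧ ∃ δ : K, 0 < δ ∧ ∀ z, Near δ z y → z ∉ F t := inferInstance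
  exact this.congr fun _ => isNowhereDense_iff_near.symm

variable (L K X) in
/-- The definable Baire category property of `X`, in its strong form. -/
def MeagerNowhereDense : Prop :=
  ∀ F : K → Set X, DefFam L K F → Monotone F → (∀ t, IsNowhereDense (F t)) →
    IsNowhereDense (⋃ t, F t)

/-- A definable pigeonhole principle: if the projection of `R` is somewhere dense, it stays so
when the values of a definable function `g` are confined to a suitable short interval. The centre
of the interval is the supremum of the bounds `y` for which `g ≤ y` leaves a nowhere dense
projection. -/
theorem MeagerNowhereDense.exists_isNowhereDense_image (hY : MeagerNowhereDense L K Y) {R : Set X}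
    [DefSet L K R] {f : X → Y} (hf : DefMap L K f) {g : X → K} (hg : DefMap L K g)
    (hR : ¬ IsNowhereDense (f '' R)) {ε : K} (hε : 0 < ε) :
    ∃ c, ¬ IsNowhereDense (f '' {x | x ∈ R ∧ |g x - c| < ε}) := by
  have hf1 : DefMap L K fun p : (K × Y) × X => f p.2 := hf.comp inferInstance
  have hg1 : DefMap L K fun p : (K × Y) × X => g p.2 := hg.comp inferInstance
  -- bound the values of `g`
  obtain ⟨N, hN⟩ : ∃ N : K, ¬ IsNowhereDense {y | ∃ x, (x ∈ R ∧ |g x| ≤ N) ∧ f x = y} := by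
    by_contra! h
    refine hR ((hY (fun N : K => {y | ∃ x, (x ∈ R ∧ |g x| ≤ N) ∧ f x = y}) inferInstance ?_ h).mono
      ?_)
    · rintro s t hst y ⟨x, hx, rfl⟩
      exact ⟨x, ⟨hx.1, hx.2.trans hst⟩, rfl⟩
    · rintro _ ⟨x, hx, rfl⟩
      exact mem_iUnion.2 ⟨|g x|, x, ⟨hx, le_rfl⟩, rfl⟩
  let S : K → Set Y := fun a => {y | ∃ x, (x ∈ R ∧ |g x| ≤ N ∧ g x ≤ a) ∧ f x = y}
  have hS : DefFam L K S := inferInstanceAs (DefFam L K fun a : K =>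
    {y | ∃ x, (x ∈ R ∧ |g x| ≤ N ∧ g x ≤ a) ∧ f x = y})
  have hSm : Monotone S := by
    rintro s t hst y ⟨x, hx, rfl⟩
    exact ⟨x, ⟨hx.1, hx.2.1, hx.2.2.trans hst⟩, rfl⟩
  have hSn := defPred_isNowhereDense hS
  obtain ⟨s, hs⟩ := exists_isLUB_of_defSet L {a | IsNowhereDense (S a)}
    ⟨-N - 1, by
      have : S (-N - 1) = ∅ := by
        refine eq_empty_of_forall_notMem ?_
        rintro y ⟨x, ⟨-, h1, h2⟩, -⟩
        linarith [(abs_le.1 h1).1]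
      simp [this]⟩
    ⟨N, fun a ha => by
      by_contra! h
      refine hN (ha.mono ?_)
      rintro y ⟨x, hx, rfl⟩
      exact ⟨x, ⟨hx.1, hx.2, ((le_abs_self _).trans hx.2).trans h.le⟩, rfl⟩⟩
  refine ⟨s, fun hc => ?_⟩
  obtain ⟨a, ha, hsa, -⟩ := hs.exists_between (sub_lt_self s hε)
  have h1 : S (s + ε / 2) ⊆ S a ∪ f '' {x | x ∈ R ∧ |g x - s| < ε} := by
    rintro _ ⟨x, ⟨hxR, hxN, hx⟩, rfl⟩
    rcases le_or_gt (g x) a with h | h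
    · exact .inl ⟨x, ⟨hxR, hxN, h⟩, rfl⟩
    · refine .inr ⟨x, ⟨hxR, abs_lt.2 ⟨?_, ?_⟩⟩, rfl⟩ <;> linarith
  have h2 := hs.1 ((isNowhereDense_union ha hc).mono h1)
  linarith

theorem MeagerNowhereDense.sdiff_interior (hX : MeagerNowhereDense L K X) {A : Set X}
    (hA : FSig L K A) : IsNowhereDense (A \ interior A) := by
  have hAd := hA.defSet
  obtain ⟨F, hF, hFm, hFc, hAF⟩ := hA
  have hd : DefFam L K fun t => F t \ interior A :=
    ⟨DefPred.congr (P := fun p : K × X => p.2 ∈ F p.1 ∧ ¬ p.2 ∈ interior A) inferInstance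
      fun _ => Iff.rfl⟩
  refine (hX _ hd (fun s t h => sdiff_subset_sdiff_left (hFm h)) fun t => ?_).mono ?_
  · rw [((hFc t).sdiff isOpen_interior).isNowhereDense_iff, eq_empty_iff_forall_notMem]
    intro x hx
    refine (interior_subset hx).2 (interior_mono ?_ hx)
    exact hAF ▸ sdiff_subset.trans (subset_iUnion F t)
  · rw [← iUnion_sdiff, ← hAF]

/-- An `F_σ` set that avoids a set `T` avoids some open set on which `T` is dense. -/
theorem MeagerNowhereDense.exists_isOpen (hX : MeagerNowhereDense L K X) {A T : Set X}
    (hA : FSig L K A) (hT : ¬ IsNowhereDense T) (hAT : ∀ x ∈ A, x ∉ T) :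
    ∃ V, IsOpen V ∧ V.Nonempty ∧ V ⊆ closure T ∧ ∀ x ∈ V, x ∉ A := by
  have hn := hX.sdiff_interior hA
  refine ⟨interior (closure T) \ closure (A \ interior A), isOpen_interior.sdiff isClosed_closure,
    ?_, sdiff_subset.trans interior_subset, fun x hx hxA => ?_⟩
  · rw [sdiff_nonempty]
    intro h
    exact hT (subset_empty_iff.1 (hn ▸ interior_maximal h isOpen_interior))
  · by_cases hxi : x ∈ interior A
    · obtain ⟨y, hy, hyT⟩ := mem_closure_iff.1 (interior_subset hx.1) _ isOpen_interior hxi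
      exact hAT y (interior_subset hy) hyT
    · exact hx.2 (subset_closure ⟨hxA, hxi⟩)

/-- A closed set without interior contains vertical segments of a given length only over a nowhere
dense set. -/
theorem MeagerNowhereDense.isNowhereDense_segments (hX : MeagerNowhereDense L K X)
    {C : Set (X × K)} [DefSet L K C] (hC : IsClosed C) (hCi : interior C = ∅) {ε : K}
    (hε : 0 < ε) : IsNowhereDense {x | ∃ c, ∀ u, c ≤ u → u ≤ c + ε → (x, u) ∈ C} := by
  by_contra hn
  have himg : {x | ∃ c, ∀ u, c ≤ u → u ≤ c + ε → (x, u) ∈ C} =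
      Prod.fst '' {p : X × K | ∀ u, p.2 ≤ u → u ≤ p.2 + ε → (p.1, u) ∈ C} := by
    ext x; simp
  rw [himg] at hn
  obtain ⟨c₀, hc⟩ := hX.exists_isNowhereDense_image DefMap.prodFst (g := Prod.snd) DefMap.prodSnd hn
    (ε := ε / 4) (by positivity)
  refine hc ?_
  set T := Prod.fst '' {x : X × K | x ∈ {p : X × K | ∀ u, p.2 ≤ u → u ≤ p.2 + ε → (p.1, u) ∈ C} ∧
    |x.2 - c₀| < ε / 4}
  have hsub : closure T ×ˢ Ioo (c₀ + ε / 4) (c₀ + 3 * ε / 4) ⊆ C := by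
    rintro ⟨x, u⟩ ⟨hx, hu⟩
    have hcl : IsClosed {x | (x, u) ∈ C} := hC.preimage (by fun_prop)
    refine hcl.closure_subset_iff.2 ?_ hx
    rintro _ ⟨⟨x, c⟩, ⟨h1, h2⟩, rfl⟩
    have h2 := abs_lt.1 h2
    dsimp only at h2 hu
    exact h1 u (by dsimp only; linarith [hu.1]) (by dsimp only; linarith [hu.2])
  refine eq_empty_of_forall_notMem fun x hx => ?_
  have hmem : (x, c₀ + ε / 2) ∈ interior C := by
    refine interior_maximal ((prod_mono_left interior_subset).trans hsub)
      (isOpen_interior.prod isOpen_Ioo) ⟨hx, ?_, ?_⟩ <;> dsimp only <;> linarith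
  simp [hCi] at hmem

/-- Over a generic base point, all members of an increasing family of closed sets without interior
have nowhere dense fibres: the exceptional points lie under arbitrarily short segments. -/
theorem MeagerNowhereDense.exists_generic_fibre (hX : MeagerNowhereDense L K X)
    {G : K → Set (X × K)} (hG : DefFam L K G) (hGm : Monotone G) (hGc : ∀ t, IsClosed (G t))
    (hGi : ∀ t, interior (G t) = ∅) :
    ∃ M : Set X, DefSet L K M ∧ IsNowhereDense M ∧
      ∀ x ∉ M, ∀ t, IsNowhereDense {u | (x, u) ∈ G t} := by
  have hGd (t : K) : DefSet L K (G t) := hG.defSet t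
  have hMfam : DefFam L K fun t : K => {x : X | 0 < t ∧ ∃ c, ∀ u, c ≤ u → u ≤ c + t⁻¹ →
    (x, u) ∈ G t} := inferInstance
  refine ⟨_, hMfam.iUnion, hX _ hMfam ?_ fun t => ?_, fun x hx t => ?_⟩
  · rintro s t hst x ⟨hs, c, hc⟩
    refine ⟨hs.trans_le hst, c, fun u hu hu' => hGm hst (hc u hu (hu'.trans ?_))⟩
    gcongr
  · rcases le_or_gt t 0 with ht | ht
    · simp [not_lt.2 ht]
    · exact (hX.isNowhereDense_segments (hGc t) (hGi t) (inv_pos.2 ht)).mono fun x hx => hx.2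
  · have hcl : IsClosed {u | (x, u) ∈ G t} := (hGc t).preimage (by fun_prop)
    rw [hcl.isNowhereDense_iff, eq_empty_iff_forall_notMem]
    intro u hu
    obtain ⟨ε, hε, h⟩ := (mem_interior_near (K := K)).1 hu
    refine hx (mem_iUnion.2 ⟨max t (ε / 2)⁻¹, ?_, u, fun u' h1 h2 => ?_⟩)
    · exact lt_max_of_lt_right (by positivity)
    · refine hGm (le_max_left _ _) (h u' (near_iff.2 ?_))
      have : (max t (ε / 2)⁻¹)⁻¹ ≤ ε / 2 :=
        inv_le_of_inv_le₀ (by positivity) (le_max_right _ _)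
      rw [abs_of_nonneg (by linarith)]
      linarith

/-- Induction on the number of coordinates. For a meager set dense in a box `U × (a, b)`, generic
fibres are meager subsets of `K`, hence nowhere dense, so they miss an interval; by the pigeonhole
principle they miss a common interval for a dense set of base points, whereas the projection of the
part of the set over that interval is an `F_σ` set containing a dense open set. -/
theorem MeagerNowhereDense.prod (hT : DiscretePFin L K) (hX : MeagerNowhereDense L K X) :
    MeagerNowhereDense L K (X × K) := by
  intro F hF hFm hFn
  let G : K → Set (X × K) := fun t => closure (F t)
  have hG : DefFam L K G := DefFam.closure
  have hGm : Monotone G := fun s t h => closure_mono (hFm h)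
  have hGc : ∀ t, IsClosed (G t) := fun t => isClosed_closure
  have hGi : ∀ t, interior (G t) = ∅ := hFn
  suffices h : IsNowhereDense (⋃ t, G t) from h.mono (iUnion_mono fun t => subset_closure)
  have hA : FSig L K (⋃ t, G t) := ⟨G, hG, hGm, hGc, rfl⟩
  generalize hAG : ⋃ t, G t = A at hA ⊢
  have hAd := hA.defSet
  have hmemA {x : X} {u : K} : (x, u) ∈ A ↔ ∃ t, (x, u) ∈ G t := hAG ▸ mem_iUnion
  obtain ⟨M, hMd, hM, hMfib⟩ := hX.exists_generic_fibre hG hGm hGc hGi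
  have hfib (x : X) (hx : x ∉ M) : PFin K {u | (x, u) ∈ A} := by
    have h1 : DefFam L K fun t : K => {u : K | (x, u) ∈ G t} := inferInstance
    have h2 := hT.iUnion h1 (fun s t h u hu => hGm h hu) fun t => by
      have := h1.defSet t
      exact hT.of_isNowhereDense (hMfib x hx t)
    convert! h2 using 1
    ext u
    simp [hmemA]
  by_contra hn
  obtain ⟨⟨x₀, y₀⟩, h₀⟩ := nonempty_iff_ne_empty.2 hn
  obtain ⟨ε, hε, hbox⟩ := (mem_interior_near (K := K)).1 h₀
  -- base points whose fibre misses an interval of a given length near `y₀`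
  let P : K → Set X := fun t => {x | (0 < t ∧ Near ε x x₀ ∧ x ∉ closure M) ∧
    ∃ c, y₀ - ε < c ∧ c + t⁻¹ < y₀ + ε ∧ ∀ u, c ≤ u → u ≤ c + t⁻¹ → (x, u) ∉ A}
  have hP : DefFam L K P := inferInstanceAs (DefFam L K fun t : K =>
    {x : X | (0 < t ∧ Near ε x x₀ ∧ x ∉ closure M) ∧
      ∃ c, y₀ - ε < c ∧ c + t⁻¹ < y₀ + ε ∧ ∀ u, c ≤ u → u ≤ c + t⁻¹ → (x, u) ∉ A})
  have hPm : Monotone P := by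
    rintro s t hst x ⟨⟨hs, h1, h2⟩, c, h3, h4, h5⟩
    have hle : t⁻¹ ≤ s⁻¹ := inv_anti₀ hs hst
    exact ⟨⟨hs.trans_le hst, h1, h2⟩, c, h3, by linarith, fun u hu hu' => h5 u hu (by linarith)⟩
  have hPu : ({x | Near ε x x₀} \ closure M) ⊆ ⋃ t, P t := by
    rintro x ⟨hx, hxM⟩
    have hfx := hfib x fun h => hxM (subset_closure h)
    obtain ⟨δ, hδ, h⟩ :=
      isClosed_and_isDiscrete_iff_near (K := K).1 ⟨hfx.isClosed, hfx.isDiscrete⟩ y₀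
    have hm : 0 < min δ ε := lt_min hδ hε
    refine mem_iUnion.2 ⟨(min δ ε / 4)⁻¹, ⟨by positivity, hx, hxM⟩, y₀ + min δ ε / 4, ?_, ?_, ?_⟩
    · linarith
    · rw [inv_inv]
      linarith [min_le_right δ ε]
    · intro u hu hu' huA
      rw [inv_inv] at hu'
      have := h u huA (near_iff.2 (abs_lt.2 ⟨by linarith, by linarith [min_le_left δ ε]⟩))
      linarith
  obtain ⟨t, ht⟩ : ∃ t, ¬ IsNowhereDense (P t) := by
    by_contra! h
    have h1 := isNowhereDense_union ((hX P hP hPm h).mono hPu) hM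
    have h2 : {x | Near ε x x₀} ⊆ interior (closure
        (({x | Near ε x x₀} \ closure M) ∪ M)) := by
      refine interior_maximal (fun x hx => ?_) (isOpen_near _ _)
      rw [closure_union]
      by_cases hxM : x ∈ closure M
      · exact .inr hxM
      · exact .inl (subset_closure ⟨hx, hxM⟩)
    rw [h1] at h2
    exact h2 (near_self hε x₀)
  have ht0 : 0 < t := by
    by_contra h
    refine ht ?_
    simp [P, h]
  set δ := t⁻¹ with hδt
  have hδ : 0 < δ := inv_pos.2 ht0
  let R : Set (X × K) := {p | (Near ε p.1 x₀ ∧ y₀ - ε < p.2 ∧ p.2 + δ < y₀ + ε) ∧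
    ∀ u, p.2 ≤ u → u ≤ p.2 + δ → (p.1, u) ∉ A}
  have hR : ¬ IsNowhereDense (Prod.fst '' R) := fun h => ht (h.mono (by
    rintro x ⟨⟨-, h1, -⟩, c, h3, h4, h5⟩
    exact ⟨(x, c), ⟨⟨h1, h3, h4⟩, h5⟩, rfl⟩))
  have hRd : DefSet L K R := inferInstance
  obtain ⟨c₀, hc⟩ := hX.exists_isNowhereDense_image DefMap.prodFst (g := Prod.snd) DefMap.prodSnd hR
    (ε := δ / 4) (by positivity)
  have hW : FSig L K (Prod.fst '' (A ∩ {p : X × K | c₀ + δ / 4 ≤ p.2 ∧ p.2 ≤ c₀ + 3 * δ / 4})) := by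
    refine (hA.inter (FSig.of_isClosed ?_)).image DefMap.prodFst continuous_fst
    exact (isClosed_le continuous_const continuous_snd).inter
      (isClosed_le continuous_snd continuous_const)
  obtain ⟨V, hV, ⟨z, hz⟩, hVT, hVW⟩ := hX.exists_isOpen hW hc (by
    rintro _ ⟨⟨x, u⟩, ⟨huA, hu⟩, rfl⟩ ⟨⟨x', c⟩, ⟨hR, hcc⟩, hxx⟩
    obtain rfl : x' = x := hxx
    have h2 := abs_lt.1 hcc
    dsimp only [mem_ofPred_eq] at hu h2
    exact hR.2 u (by dsimp only; linarith) (by dsimp only; linarith) huA)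
  obtain ⟨_, hxV, ⟨x, c⟩, ⟨hxR, hcc⟩, rfl⟩ := mem_closure_iff.1 (hVT hz) V hV hz
  have h2 := abs_lt.1 hcc
  have h3 := hxR.1
  dsimp only at h2 h3 hxV
  have hcl : (x, c₀ + δ / 2) ∈ closure A := hbox _ (near_prod.2 ⟨h3.1, near_iff.2
    (abs_lt.2 ⟨by dsimp only; linarith, by dsimp only; linarith⟩)⟩)
  obtain ⟨⟨x', u⟩, ⟨hx', hu⟩, hA'⟩ := mem_closure_iff.1 hcl (V ×ˢ Ioo (c₀ + δ / 4) (c₀ + 3 * δ / 4))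
    (hV.prod isOpen_Ioo) ⟨hxV, by dsimp only; linarith, by dsimp only; linarith⟩
  exact hVW x' hx' ⟨(x', u), ⟨hA', hu.1.le, hu.2.le⟩, rfl⟩

theorem MeagerNowhereDense.of_homeomorph (hX : MeagerNowhereDense L K X) (e : X ≃ₜ Y)
    (he : DefMap L K e) : MeagerNowhereDense L K Y := by
  intro F hF hFm hFn
  have he' : DefMap L K fun p : K × X => e p.2 := he.comp inferInstance
  have hd : DefFam L K fun t => e ⁻¹' F t :=
    ⟨DefPred.congr (P := fun p : K × X => e p.2 ∈ F p.1) inferInstance fun _ => Iff.rfl⟩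
  have h := hX _ hd (fun s t h => preimage_mono (hFm h)) fun t => by
    rw [← e.image_symm]
    exact e.symm.isInducing.isNowhereDense_image (hFn t)
  have h2 := e.isInducing.isNowhereDense_image h
  rwa [← preimage_iUnion, image_preimage_eq _ e.surjective] at h2

/-- The space `Fin 0 → K` is a point. -/
theorem eq_empty_of_isNowhereDense {A : Set (Fin 0 → K)} (hA : IsNowhereDense A) : A = ∅ := by
  refine eq_empty_of_forall_notMem fun x hx => ?_
  have hu : A = univ := eq_univ_of_forall fun y => Subsingleton.elim x y ▸ hx
  rw [hu, IsNowhereDense, closure_univ, interior_univ] at hA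
  exact univ_nonempty.ne_empty hA

/-- The homeomorphism that puts the last factor first. -/
def consHomeomorph (n : ℕ) : (Fin n → K) × K ≃ₜ (Fin (n + 1) → K) where
  toFun p := Fin.cons p.2 p.1
  invFun x := (Fin.tail x, x 0)
  left_inv p := by simp
  right_inv x := by simp
  continuous_toFun := by fun_prop
  continuous_invFun := by unfold Fin.tail; fun_prop

theorem DiscretePFin.meagerNowhereDense (hT : DiscretePFin L K) (n : ℕ) :
    MeagerNowhereDense L K (Fin n → K) := by
  induction n with
  | zero =>
    intro F hF hFm hFn
    have : ⋃ t, F t = ∅ := iUnion_eq_empty.2 fun t => eq_empty_of_isNowhereDense (hFn t)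
    rw [this]
    exact isNowhereDense_empty
  | succ n ih =>
    refine (ih.prod hT).of_homeomorph (consHomeomorph n) (.pi fun i => ?_)
    refine Fin.cases ?_ (fun j => ?_) i
    · exact (inferInstance : DefMap L K fun p : (Fin n → K) × K => p.2)
    · exact (inferInstance : DefMap L K fun p : (Fin n → K) × K => p.1 j)

end FSigma

/-! ### The frontier of an `F_σ` set and constructibility -/

section Frontier

variable {L : FirstOrder.Language.{u, v}} {K : Type w} [L.Structure K] [Field K] [LinearOrder K]
  [IsStrictOrderedRing K] [TopologicalSpace K] [OrderTopology K] [hK : DefCompleteField L K]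

omit [L.Structure K] [Field K] [LinearOrder K] [IsStrictOrderedRing K] [OrderTopology K] hK in
theorem continuous_precomp {m n : ℕ} (σ : Fin m → Fin n) :
    Continuous fun x : Fin n → K => x ∘ σ :=
  continuous_pi fun i => continuous_apply (σ i)

theorem isNowhereDense_iUnion_finite {X ι : Type*} [TopologicalSpace X] [Finite ι] {E : ι → Set X}
    (hE : ∀ i, IsNowhereDense (E i)) : IsNowhereDense (⋃ i, E i) := by
  classical
  have := Fintype.ofFinite ι
  have key (s : Finset ι) : IsNowhereDense (⋃ i ∈ s, E i) := by
    induction s using Finset.induction_on with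
    | empty => simp
    | insert a s _ ih =>
      rw [Finset.set_biUnion_insert]
      exact isNowhereDense_union (hE a) ih
  simpa using key Finset.univ

/-- If `A` has nowhere dense projections to `d + 1` coordinates, then its fibres over generic points
of `d` coordinates have pseudo-finite projections to each coordinate. -/
theorem DiscretePFin.exists_generic_pFin (hT : DiscretePFin L K) {n d : ℕ} {A : Set (Fin n → K)}
    [DefSet L K A] (hA : ∀ τ : Fin (d + 1) → Fin n, IsNowhereDense ((fun x => x ∘ τ) '' A))
    (σ : Fin d → Fin n) : ∃ E : Set (Fin d → K), DefSet L K E ∧ IsNowhereDense E ∧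
      ∀ y ∉ E, ∀ i, PFin K {c | ∃ x, x ∈ A ∧ x ∘ σ = y ∧ x i = c} := by
  have key (i : Fin n) : ∃ E : Set (Fin d → K), DefSet L K E ∧ IsNowhereDense E ∧
      ∀ y ∉ E, PFin K {c | ∃ x, x ∈ A ∧ x ∘ σ = y ∧ x i = c} := by
    let B : Set ((Fin d → K) × K) := {p | ∃ x, x ∈ A ∧ x ∘ σ = p.1 ∧ x i = p.2}
    have hBd : DefSet L K B := inferInstance
    have hB : IsNowhereDense B := by
      have h := (consHomeomorph d).symm.isInducing.isNowhereDense_image (hA (Fin.cons i σ))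
      refine h.mono ?_
      rintro ⟨_, _⟩ ⟨x, hx, rfl, rfl⟩
      exact ⟨_, ⟨x, hx, rfl⟩, rfl⟩
    have hBc : DefFam L K fun _ : K => closure B := ⟨inferInstance⟩
    obtain ⟨E, hEd, hE, h⟩ := (hT.meagerNowhereDense d).exists_generic_fibre hBc monotone_const
      (fun _ => isClosed_closure) (fun _ => hB)
    refine ⟨E, hEd, hE, fun y hy => ?_⟩
    have h1 : DefSet L K {u : K | (y, u) ∈ closure B} := inferInstance
    refine (hT.of_isNowhereDense (h y hy 0)).mono ?_
    rintro _ ⟨x, hx, rfl, rfl⟩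
    exact subset_closure ⟨x, hx, rfl, rfl⟩
  choose E hEd hE h using key
  refine ⟨⋃ i, E i, ?_, isNowhereDense_iUnion_finite hE, fun y hy i => h i y fun hi =>
    hy (mem_iUnion.2 ⟨i, hi⟩)⟩
  exact ⟨DefPred.congr (P := fun y => ∃ i, y ∈ E i) inferInstance fun _ => mem_iUnion.symm⟩

theorem DefSet.sdiff {X : Type*} [TopologicalSpace X] [Coord K X] {A B : Set X}
    (hA : DefSet L K A) (hB : DefSet L K B) : DefSet L K (A \ B) :=
  ⟨DefPred.congr (P := fun x => x ∈ A ∧ ¬ x ∈ B) inferInstance fun _ => Iff.rfl⟩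

/-- The frontier inequality: if an `F_σ` set has nowhere dense projections to any `d + 1`
coordinates, its frontier has nowhere dense projections to any `d` coordinates. Fibres over generic
points are closed, so a frontier point over such a point keeps a distance `ε` from its fibre; by the
pigeonhole principle these frontier points may be taken in one box of size `ε`, and the part of the
set in this box has a projection avoiding a somewhere dense set. -/
theorem DiscretePFin.isNowhereDense_frontier (hT : DiscretePFin L K) {n d : ℕ}
    {A : Set (Fin n → K)} (hA : FSig L K A)
    (hAd : ∀ τ : Fin (d + 1) → Fin n, IsNowhereDense ((fun x => x ∘ τ) '' A)) (σ : Fin d → Fin n) :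
    IsNowhereDense ((fun x => x ∘ σ) '' (closure A \ A)) := by
  have hAdef := hA.defSet
  have hd := hT.meagerNowhereDense d
  have hσ : DefMap L K fun x : Fin n → K => x ∘ σ := inferInstance
  obtain ⟨E, hEd, hE, hfib⟩ := hT.exists_generic_pFin hAd σ
  by_contra hn
  -- frontier points over generic points at distance `t⁻¹` from their fibre
  let P : K → Set (Fin d → K) := fun t => {y | 0 < t ∧ ∃ z, (z ∈ closure A ∧ z ∘ σ ∉ E ∧
    ∀ x, x ∈ A → x ∘ σ = z ∘ σ → ¬ Near t⁻¹ x z) ∧ z ∘ σ = y}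
  have hP : DefFam L K P := inferInstanceAs (DefFam L K fun t : K =>
    {y : Fin d → K | 0 < t ∧ ∃ z, (z ∈ closure A ∧ z ∘ σ ∉ E ∧
      ∀ x, x ∈ A → x ∘ σ = z ∘ σ → ¬ Near t⁻¹ x z) ∧ z ∘ σ = y})
  have hPm : Monotone P := by
    rintro s t hst y ⟨hs, z, ⟨h1, h2, h3⟩, h4⟩
    exact ⟨hs.trans_le hst, z,
      ⟨h1, h2, fun x hx hxz hn => h3 x hx hxz (hn.mono (inv_anti₀ hs hst))⟩, h4⟩
  have hPu : (fun x => x ∘ σ) '' (closure A \ A) ⊆ (⋃ t, P t) ∪ E := by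
    rintro _ ⟨z, ⟨hz, hzA⟩, rfl⟩
    by_cases hzE : z ∘ σ ∈ E
    · exact .inr hzE
    refine .inl (mem_iUnion.2 ?_)
    have h1 (i : Fin n) : ∃ ε : K, 0 < ε ∧ ∀ x, x ∈ A → x ∘ σ = z ∘ σ → |x i - z i| < ε →
        x i = z i := by
      have hf := hfib _ hzE i
      obtain ⟨ε, hε, h⟩ := isClosed_and_isDiscrete_iff_near (K := K).1
        ⟨hf.isClosed, hf.isDiscrete⟩ (z i)
      exact ⟨ε, hε, fun x hx hxz hn => h _ ⟨x, hx, hxz, rfl⟩ (near_iff.2 hn)⟩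
    choose e he h2 using h1
    obtain ⟨ε, hε, hle⟩ := exists_pos_forall_le he
    refine ⟨ε⁻¹, inv_pos.2 hε, z, ⟨hz, hzE, fun x hx hxz hn => hzA ?_⟩, rfl⟩
    rw [inv_inv] at hn
    have : x = z := funext fun i => h2 i x hx hxz ((near_pi.1 hn i).trans_le (hle i))
    exact this ▸ hx
  obtain ⟨t, ht⟩ : ∃ t, ¬ IsNowhereDense (P t) := by
    by_contra! h
    exact hn ((isNowhereDense_union (hd P hP hPm h) hE).mono hPu)
  have ht0 : 0 < t := by
    by_contra h
    refine ht ?_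
    simp [P, h]
  set ε := t⁻¹ with hεt
  have hε : 0 < ε := inv_pos.2 ht0
  let R : Set (Fin n → K) := {z | z ∈ closure A ∧ z ∘ σ ∉ E ∧
    ∀ x, x ∈ A → x ∘ σ = z ∘ σ → ¬ Near ε x z}
  have hRd : DefSet L K R := inferInstance
  have hR : ¬ IsNowhereDense ((fun x => x ∘ σ) '' R) := fun h => ht (h.mono (by
    rintro _ ⟨-, z, hz, rfl⟩
    exact ⟨z, hz, rfl⟩))
  -- confine all coordinates
  have key (s : Finset (Fin n)) : ∃ c : Fin n → K, ¬ IsNowhereDense ((fun x => x ∘ σ) ''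
      {z | z ∈ R ∧ ∀ i, i ∈ s → |z i - c i| < ε / 2}) := by
    induction s using Finset.induction_on with
    | empty => exact ⟨0, by simpa using hR⟩
    | insert j s hj ih =>
      obtain ⟨c, hc⟩ := ih
      obtain ⟨a, ha⟩ := hd.exists_isNowhereDense_image hσ (g := fun z => z j) inferInstance hc
        (half_pos hε)
      refine ⟨Function.update c j a, fun h => ha (h.mono (image_mono ?_))⟩
      rintro z ⟨⟨hz, hzs⟩, hzj⟩
      refine ⟨hz, fun i hi => ?_⟩
      rcases eq_or_ne i j with rfl | hij
      · simpa using hzj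
      · rw [Function.update_of_ne hij]
        exact hzs i (Finset.mem_of_mem_insert_of_ne hi hij)
  obtain ⟨c, hc⟩ := key Finset.univ
  simp only [Finset.mem_univ, true_imp_iff] at hc
  let Q : Set (Fin n → K) := {x | Near (ε / 2) x c}
  have hQ : IsOpen Q := isOpen_near _ c
  have hW : FSig L K ((fun x => x ∘ σ) '' (A ∩ Q)) :=
    (hA.inter (FSig.of_isOpen hQ)).image hσ (continuous_precomp σ)
  obtain ⟨V, hV, ⟨y, hy⟩, hVT, hVW⟩ := hd.exists_isOpen hW hc (by
    rintro _ ⟨x, ⟨hxA, hxQ⟩, rfl⟩ ⟨z, ⟨hzR, hzQ⟩, hzx⟩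
    have hzQ : Near (ε / 2) z c := near_pi.2 hzQ
    have hn := hxQ.trans hzQ.symm
    rw [add_halves] at hn
    exact hzR.2.2 x hxA hzx.symm hn)
  obtain ⟨_, hzV, z, ⟨hzR, hzQ⟩, rfl⟩ := mem_closure_iff.1 (hVT hy) V hV hy
  obtain ⟨x, ⟨hxQ, hxV⟩, hxA⟩ := mem_closure_iff.1 hzR.1 (Q ∩ (fun x => x ∘ σ) ⁻¹' V)
    (hQ.inter (hV.preimage (continuous_precomp σ))) ⟨near_pi.2 hzQ, hzV⟩
  exact hVW _ hxV ⟨x, ⟨hxA, hxQ⟩, rfl⟩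

theorem Constructible.of_isOpen {X : Type*} [TopologicalSpace X] {A : Set X} (hA : IsOpen A) :
    Constructible A := BooleanSubalgebra.subset_closure hA

theorem Constructible.compl {X : Type*} [TopologicalSpace X] {A : Set X} (hA : Constructible A) :
    Constructible Aᶜ := BooleanSubalgebra.compl_mem hA

theorem Constructible.union {X : Type*} [TopologicalSpace X] {A B : Set X} (hA : Constructible A)
    (hB : Constructible B) : Constructible (A ∪ B) := BooleanSubalgebra.sup_mem hA hB

theorem Constructible.inter {X : Type*} [TopologicalSpace X] {A B : Set X} (hA : Constructible A)
    (hB : Constructible B) : Constructible (A ∩ B) := BooleanSubalgebra.inf_mem hA hB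

/-- Up to the part of `A` in the closure `Y` of its frontier, which has smaller dimension, `A` is
the locally closed set `closure A \ Y`. -/
theorem DiscretePFin.constructible_of_isNowhereDense (hT : DiscretePFin L K) {n : ℕ} (d : ℕ)
    {A : Set (Fin n → K)} (hA : FSig L K A)
    (hAd : ∀ τ : Fin d → Fin n, IsNowhereDense ((fun x => x ∘ τ) '' A)) :
    Constructible A ∧ FSig L K Aᶜ := by
  induction d generalizing A with
  | zero =>
    obtain rfl : A = ∅ := image_eq_empty.1 (eq_empty_of_isNowhereDense (hAd Fin.elim0))
    refine ⟨Constructible.of_isOpen isOpen_empty, ?_⟩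
    have : DefSet L K (univ : Set (Fin n → K)) := ⟨(DefPred.const True).congr fun _ => by simp⟩
    exact compl_empty ▸ FSig.of_isClosed isClosed_univ
  | succ d ih =>
    have hAdef := hA.defSet
    let Y := closure (closure A \ A)
    have hfr : DefSet L K (closure A \ A) := DefSet.sdiff inferInstance hAdef
    have hY : DefSet L K Y := DefSet.closure
    have hAY : FSig L K (A ∩ Y) := hA.inter (FSig.of_isClosed isClosed_closure)
    obtain ⟨h1, h2⟩ := ih hAY fun τ => (hT.isNowhereDense_frontier hA hAd τ).closure.mono <|
      (image_mono inter_subset_right).trans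
        (image_closure_subset_closure_image (continuous_precomp τ))
    have hmem (x) : x ∈ A ↔ x ∈ closure A ∧ (x ∉ Y ∨ x ∈ A ∩ Y) := by
      refine ⟨fun hx => ⟨subset_closure hx, ?_⟩, ?_⟩
      · by_cases hxY : x ∈ Y
        · exact .inr ⟨hx, hxY⟩
        · exact .inl hxY
      · rintro ⟨hx, h | h⟩
        · by_contra hxA
          exact h (subset_closure ⟨hx, hxA⟩)
        · exact h.1
    have hAeq : A = closure A ∩ (Yᶜ ∪ A ∩ Y) := ext hmem
    have hYo : IsOpen Yᶜ := isClosed_closure.isOpen_compl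
    have hAo : IsOpen (closure A)ᶜ := isClosed_closure.isOpen_compl
    constructor
    · rw [hAeq]
      refine Constructible.inter ?_ ((Constructible.of_isOpen hYo).union h1)
      exact compl_compl (closure A) ▸ (Constructible.of_isOpen hAo).compl
    · have hc : DefSet L K (closure A)ᶜ :=
        ⟨DefPred.congr (P := fun x => ¬ x ∈ closure A) inferInstance fun _ => Iff.rfl⟩
      have : Aᶜ = (closure A)ᶜ ∪ (Y ∩ (A ∩ Y)ᶜ) := by
        ext x
        have := hmem x
        simp only [mem_compl_iff, mem_union, mem_inter_iff]
        simp only [mem_inter_iff] at this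
        tauto
      rw [this]
      exact (FSig.of_isOpen hAo).union ((FSig.of_isClosed isClosed_closure).inter h2)

/-- Any projection of `K ^ n` to `n + 1` coordinates repeats a coordinate. -/
theorem isNowhereDense_image_succ {n : ℕ} (A : Set (Fin n → K)) (τ : Fin (n + 1) → Fin n) :
    IsNowhereDense ((fun x => x ∘ τ) '' A) := by
  obtain ⟨a, b, hab, hτ⟩ : ∃ a b, a ≠ b ∧ τ a = τ b := by
    by_contra! h
    have := Fintype.card_le_of_injective τ fun a b hab => by_contra fun hne => h a b hne hab
    simp at this
  have hcl : IsClosed {y : Fin (n + 1) → K | y a = y b} :=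
    isClosed_eq (continuous_apply a) (continuous_apply b)
  have hnd : IsNowhereDense {y : Fin (n + 1) → K | y a = y b} := by
    rw [hcl.isNowhereDense_iff, eq_empty_iff_forall_notMem]
    intro y hy
    obtain ⟨ε, hε, h⟩ := (mem_interior_near (K := K)).1 hy
    have hy' : y ∈ {y : Fin (n + 1) → K | y a = y b} := interior_subset hy
    have hn : Near ε (Function.update y a (y a + ε / 2)) y := near_pi.2 fun i => by
      rcases eq_or_ne i a with rfl | hi
      · rw [Function.update_self, add_sub_cancel_left, abs_of_pos (half_pos hε)]
        exact half_lt_self hε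
      · simpa [Function.update_of_ne hi] using hε
    have := h _ hn
    rw [mem_ofPred_eq] at hy'
    rw [mem_ofPred_eq, Function.update_self, Function.update_of_ne hab.symm] at this
    linarith
  refine hnd.mono ?_
  rintro _ ⟨x, -, rfl⟩
  exact congrArg x hτ

theorem DiscretePFin.constructible (hT : DiscretePFin L K) {n : ℕ} {A : Set (Fin n → K)}
    (hA : FSig L K A) : Constructible A :=
  (hT.constructible_of_isNowhereDense (n + 1) hA (isNowhereDense_image_succ A)).1

theorem DiscretePFin.fSig_compl_pi (hT : DiscretePFin L K) {n : ℕ} {A : Set (Fin n → K)}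
    (hA : FSig L K A) : FSig L K Aᶜ :=
  (hT.constructible_of_isNowhereDense (n + 1) hA (isNowhereDense_image_succ A)).2

end Frontier

/-! ### Sets definable in the open core -/

section OpenCore

variable {L : FirstOrder.Language.{u, v}} {K : Type w} [L.Structure K] [Field K] [LinearOrder K]
  [IsStrictOrderedRing K] [TopologicalSpace K] [OrderTopology K] [hK : DefCompleteField L K]
variable {X : Type*} [TopologicalSpace X] [Coord K X]

theorem DiscretePFin.fSig_compl (hT : DiscretePFin L K) {A : Set X} (hA : FSig L K A) :
    FSig L K Aᶜ := by
  obtain ⟨n, ⟨e⟩⟩ := Finite.exists_equiv_fin (Coord.Idx K X)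
  let f : X → Fin n → K := fun x => Coord.co x ∘ e.symm
  let g : (Fin n → K) → X := fun y => Coord.co.symm (y ∘ e)
  have hgf (x : X) : g (f x) = x := by
    simp only [g, f, Function.comp_assoc, Equiv.symm_comp_self, Function.comp_id,
      Homeomorph.symm_apply_apply]
  have hf : DefMap L K f := .of_reindex _ e.symm fun _ => rfl
  have hg : DefMap L K g := .of_reindex _ e fun _ => Homeomorph.apply_symm_apply _ _
  have hfc : Continuous f := continuous_pi fun i => continuous_co_apply (K := K) (e.symm i)
  have hgc : Continuous g :=
    Coord.co.symm.continuous.comp (continuous_pi fun i => continuous_apply (e i))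
  have h := (hT.fSig_compl_pi (hA.preimage hg hgc)).preimage hf hfc
  convert! h using 1
  ext x
  simp [hgf]

open FirstOrder Language in
/-- Terms of the open core are variables or constants. -/
theorem openCore_term {α : Type} [Finite α] {n : ℕ}
    (t : ((openCore L K)[[(univ : Set K)]]).Term (α ⊕ Fin n)) :
    DefMap L K (fun p : (α → K) × (Fin n → K) => t.realize (Sum.elim p.1 p.2)) ∧
      Continuous fun p : (α → K) × (Fin n → K) => t.realize (Sum.elim p.1 p.2) := by
  cases t with
  | var a =>
    rcases a with a | i
    · simp only [Term.realize_var, Sum.elim_inl]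
      exact ⟨inferInstance, by fun_prop⟩
    · simp only [Term.realize_var, Sum.elim_inr]
      exact ⟨inferInstance, by fun_prop⟩
  | @func l f ts =>
    have hl : IsEmpty (Fin l) := by
      rcases f with f | f
      · exact f.elim
      · match l, f with
        | 0, _ => infer_instance
    have h (p q : (α → K) × (Fin n → K)) : (Term.func f ts).realize (Sum.elim p.1 p.2) =
        (Term.func f ts).realize (Sum.elim q.1 q.2) := by
      simp only [Term.realize]
      congr 1
      exact Subsingleton.elim _ _
    obtain ⟨c, hc⟩ : ∃ c, ∀ p : (α → K) × (Fin n → K),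
        (Term.func f ts).realize (Sum.elim p.1 p.2) = c :=
      ⟨(Term.func f ts).realize (Sum.elim (fun _ => 0) fun _ => 0), fun p => h p (_, _)⟩
    simp only [hc]
    exact ⟨inferInstance, continuous_const⟩

open FirstOrder Language in
/-- All sets definable in the open core are `F_σ`, since these sets form a class that contains the
definable open sets and is closed under Boolean operations and projections. -/
theorem DiscretePFin.fSig_realize (hT : DiscretePFin L K) {α : Type} [Finite α] {n : ℕ}
    (φ : ((openCore L K)[[(univ : Set K)]]).BoundedFormula α n) :
    FSig L K {p : (α → K) × (Fin n → K) | φ.Realize p.1 p.2} := by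
  induction φ with
  | @falsum n =>
    have : DefSet L K (∅ : Set ((α → K) × (Fin n → K))) :=
      ⟨(DefPred.const False).congr fun _ => by simp⟩
    have h : FSig L K (∅ : Set ((α → K) × (Fin n → K))) := .of_isClosed isClosed_empty
    convert! h using 1
  | equal t₁ t₂ =>
    obtain ⟨h1, h1c⟩ := openCore_term t₁
    obtain ⟨h2, h2c⟩ := openCore_term t₂
    simp only [BoundedFormula.Realize]
    exact FSig.of_isClosed (isClosed_eq h1c h2c)
  | @rel m l R ts =>
    rcases R with U | R
    · have hU : FSig L K U.1 := by
        have : DefSet L K U.1 := defSet_iff_def.2 U.2.1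
        exact .of_isOpen U.2.2
      exact hU.preimage (f := fun (p : (α → K) × (Fin m → K)) i =>
        (ts i).realize (Sum.elim p.1 p.2)) (.pi fun i => (openCore_term (ts i)).1)
        (continuous_pi fun i => (openCore_term (ts i)).2)
    · exact isEmptyElim R
  | imp φ ψ hφ hψ =>
    convert! (hT.fSig_compl hφ).union hψ using 1
    ext p
    simp [imp_iff_not_or]
  | @all m φ hφ =>
    have h := hT.fSig_compl ((hT.fSig_compl hφ).image
      (f := fun p : (α → K) × (Fin (m + 1) → K) => (p.1, p.2 ∘ Fin.castSucc))
      (.pair inferInstance inferInstance)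
      (continuous_fst.prodMk ((continuous_precomp _).comp continuous_snd)))
    convert! h using 1
    ext ⟨v, xs⟩
    simp only [BoundedFormula.realize_all, mem_ofPred_eq, mem_compl_iff, mem_image, Prod.exists,
      Prod.mk.injEq, not_exists, not_and]
    constructor
    · rintro hall w ys hy rfl rfl
      refine hy ?_
      have := hall (ys (Fin.last m))
      convert! this using 1
      exact (Fin.snoc_init_self ys).symm
    · intro hall x
      by_contra hx
      exact hall v _ hx rfl (Fin.init_snoc (α := fun _ => K) x xs)

open FirstOrder Language in
theorem DiscretePFin.fSig_of_openCore (hT : DiscretePFin L K) {A : Set K}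
    (hA : DefSet (openCore L K) K A) : FSig L K A := by
  obtain ⟨φ, hφ⟩ := defSet_iff_def₁.1 hA
  have h := (hT.fSig_realize φ).preimage (f := fun x : K => ((fun _ => x : Fin 1 → K), default))
    (.pair (.pi fun _ => inferInstance) inferInstance)
    (Continuous.prodMk (continuous_pi fun _ => continuous_id) continuous_const)
  convert! h using 1
  ext x
  exact iff_of_eq (congrArg (fun S => (fun _ => x) ∈ S) hφ)

omit [Field K] [LinearOrder K] [IsStrictOrderedRing K] [OrderTopology K] hK in
open FirstOrder Language in
theorem defSet_openCore {U : Set K} (hU : DefSet L K U) (hUo : IsOpen U) :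
    DefSet (openCore L K) K U := by
  let r : (openCore L K).Relations 1 :=
    ⟨{x | x 0 ∈ U}, defSet_iff_def₁.1 hU, hUo.preimage (continuous_apply 0)⟩
  refine defSet_iff_def₁.2 (Definable.mono
    (empty_definable_iff.2 ⟨r.formula fun i => Term.var i, ?_⟩) (empty_subset _))
  ext x
  rw [mem_ofPred_eq, mem_ofPred_eq, Formula.realize_rel]
  rfl

theorem DiscretePFin.meagerNowhereDense_self (hT : DiscretePFin L K) : MeagerNowhereDense L K K :=
  (hT.meagerNowhereDense 1).of_homeomorph (Homeomorph.funUnique (Fin 1) K)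
    (DefMap.proj (0 : Fin 1))

/-- The only points around which membership in `A` is not locally constant lie in a pseudo-finite
set. -/
theorem DiscretePFin.exists_forall_Ioo_iff (hT : DiscretePFin L K) {A : Set K} (hA : FSig L K A)
    (x : K) : ∃ y > x, ∀ u ∈ Ioo x y, ∀ v ∈ Ioo x y, u ∈ A → v ∈ A := by
  have hM := hT.meagerNowhereDense_self
  have hAc := hT.fSig_compl hA
  have hAd := hA.defSet
  have hAcd := hAc.defSet
  have hd1 : DefSet L K (A \ interior A) := DefSet.sdiff inferInstance inferInstance
  have hd2 : DefSet L K (Aᶜ \ interior Aᶜ) := DefSet.sdiff inferInstance inferInstance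
  have hp1 := hT.of_isNowhereDense (hM.sdiff_interior hA)
  have hp2 := hT.of_isNowhereDense (hM.sdiff_interior hAc)
  obtain ⟨ε, hε, h1⟩ := isClosed_and_isDiscrete_iff_near (K := K).1 ⟨hp1.isClosed, hp1.isDiscrete⟩ x
  obtain ⟨δ, hδ, h2⟩ := isClosed_and_isDiscrete_iff_near (K := K).1 ⟨hp2.isClosed, hp2.isDiscrete⟩ x
  refine ⟨x + min ε δ, by simp [hε, hδ], ?_⟩
  have hloc (z : K) (hz : z ∈ Ioo x (x + min ε δ)) : z ∈ interior A ∨ z ∈ interior Aᶜ := by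
    by_contra! hn
    have hz1 : |z - x| < min ε δ := by
      rw [abs_of_pos (sub_pos.2 hz.1)]
      linarith [hz.2]
    by_cases hzA : z ∈ A
    · exact hz.1.ne' (h1 z ⟨hzA, hn.1⟩ (near_iff.2 (hz1.trans_le (min_le_left _ _))))
    · exact hz.1.ne' (h2 z ⟨hzA, hn.2⟩ (near_iff.2 (hz1.trans_le (min_le_right _ _))))
  -- an interval is definably connected
  have hconn (B : Set K) [DefSet L K B] (u v : K) (huv : u < v)
      (hB : ∀ z, u ≤ z → z ≤ v → z ∈ interior B ∨ z ∈ interior Bᶜ) (hu : u ∈ B) : v ∈ B := by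
    by_contra hv
    have huS : u ∈ {w | u ≤ w ∧ w ≤ v ∧ ∀ z, u ≤ z → z ≤ w → z ∈ B} :=
      ⟨le_rfl, huv.le, fun z h1 h2 => le_antisymm h2 h1 ▸ hu⟩
    obtain ⟨s, hs⟩ := exists_isLUB_of_defSet L {w | u ≤ w ∧ w ≤ v ∧ ∀ z, u ≤ z → z ≤ w → z ∈ B}
      ⟨u, huS⟩ ⟨v, fun w hw => hw.2.1⟩
    have hsv : s ≤ v := hs.2 fun w hw => hw.2.1
    rcases hB s (hs.1 huS) hsv with h | h
    · obtain ⟨η, hη, h⟩ := (mem_interior_near (K := K)).1 h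
      obtain ⟨w, hw, hsw, -⟩ := hs.exists_between (sub_lt_self s hη)
      have hall (z : K) (hz : u ≤ z) (hz' : z ≤ s + η / 2) : z ∈ B := by
        rcases le_or_gt z w with hzw | hzw
        · exact hw.2.2 z hz hzw
        · exact h z (near_iff.2 (abs_lt.2 ⟨by linarith, by linarith⟩))
      rcases le_or_gt v (s + η / 2) with hvs | hvs
      · exact hv (hall v huv.le hvs)
      · have := hs.1 ⟨(hs.1 huS).trans (by linarith), hvs.le, hall⟩
        linarith
    · obtain ⟨η, hη, h⟩ := (mem_interior_near (K := K)).1 h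
      obtain ⟨w, hw, hsw, hws⟩ := hs.exists_between (sub_lt_self s hη)
      exact h w (near_iff.2 (abs_lt.2 ⟨by linarith, by linarith⟩)) (hw.2.2 w hw.1 le_rfl)
  intro u hu v hv huA
  rcases lt_trichotomy u v with h | rfl | h
  · exact hconn A u v h (fun z h1 h2 => hloc z ⟨hu.1.trans_le h1, h2.trans_lt hv.2⟩) huA
  · exact huA
  · by_contra hvA
    refine hconn Aᶜ v u h (fun z h1 h2 => ?_) hvA huA
    rw [compl_compl, or_comm]
    exact hloc z ⟨hv.1.trans_le h1, h2.trans_lt hu.2⟩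

theorem defMap_iff_defFun₁ {L : FirstOrder.Language.{u, v}} {K : Type w} [L.Structure K]
    [TopologicalSpace K] {f : K → K} : DefMap L K f ↔ DefFun₁ L f :=
  ⟨fun h => defPred_iff_definable₂.1 h.graph, fun h => ⟨defPred_iff_definable₂.2 h⟩⟩

theorem DiscretePFin.locallyOMinimal (hT : DiscretePFin L K) :
    LocallyOMinimal (openCore L K) K := by
  intro f hf x
  have hf' : DefMap (openCore L K) K f := defMap_iff_defFun₁.2 hf
  have hpos : DefSet (openCore L K) K (Ioi (0 : K)) :=
    defSet_openCore (inferInstanceAs (DefSet L K {z : K | 0 < z})) isOpen_Ioi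
  have hneg : DefSet (openCore L K) K (Iio (0 : K)) :=
    defSet_openCore (inferInstanceAs (DefSet L K {z : K | z < 0})) isOpen_Iio
  have h1 : DefSet (openCore L K) K {z | f z ∈ Ioi (0 : K)} := inferInstance
  have h2 : DefSet (openCore L K) K {z | f z ∈ Iio (0 : K)} := inferInstance
  obtain ⟨y₁, hy₁, h1⟩ := hT.exists_forall_Ioo_iff (hT.fSig_of_openCore h1) x
  obtain ⟨y₂, hy₂, h2⟩ := hT.exists_forall_Ioo_iff (hT.fSig_of_openCore h2) x
  have hy : x < min y₁ y₂ := lt_min hy₁ hy₂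
  have hs1 : Ioo x (min y₁ y₂) ⊆ Ioo x y₁ := Ioo_subset_Ioo_right (min_le_left _ _)
  have hs2 : Ioo x (min y₁ y₂) ⊆ Ioo x y₂ := Ioo_subset_Ioo_right (min_le_right _ _)
  refine ⟨min y₁ y₂, hy, ?_⟩
  obtain ⟨m, hm⟩ := exists_between hy
  rcases lt_trichotomy (f m) 0 with h | h | h
  · exact .inr (.inr fun z hz => h2 m (hs2 hm) z (hs2 hz) h)
  · refine .inr (.inl fun z hz => ?_)
    by_contra hne
    rcases lt_or_gt_of_ne hne with h' | h'
    · exact (h2 z (hs2 hz) m (hs2 hm) h').ne h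
    · exact (h1 z (hs1 hz) m (hs1 hm) h').ne' h
  · exact .inl fun z hz => h1 m (hs1 hm) z (hs1 hz) h

end OpenCore

/-! ### The remaining implications -/

section Equivalences

variable {L : FirstOrder.Language.{u, v}} {K : Type w} [L.Structure K] [Field K] [LinearOrder K]
  [IsStrictOrderedRing K] [TopologicalSpace K] [OrderTopology K] [hK : DefCompleteField L K]
variable {X : Type*} [TopologicalSpace X] [Coord K X]

omit hK in
theorem pFin_iff_near {S : Set X} : PFin K S ↔ (∃ b : K, ∀ x ∈ S, Within b x) ∧
    ∀ x, ∃ ε : K, 0 < ε ∧ ∀ y ∈ S, Near ε y x → y = x := by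
  rw [← isClosed_and_isDiscrete_iff_near]
  exact ⟨fun h => ⟨h.2, h.1, h.3⟩, fun h => ⟨h.2.1, h.1, h.2.2⟩⟩

omit hK in
/-- The line `K` and the power `Fin 1 → K` have the same pseudo-finite sets. -/
theorem pFin_fin_one_iff {S : Set K} : PFin K {x : Fin 1 → K | x 0 ∈ S} ↔ PFin K S := by
  simp only [pFin_iff_near, near_pi, near_iff, within_pi, within_iff]
  refine and_congr (exists_congr fun b => ⟨fun h x hx => h (fun _ => x) hx 0, fun h x hx i => ?_⟩)
    ⟨fun h x => ?_, fun h x => ?_⟩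
  · rw [Subsingleton.elim i 0]
    exact h _ hx
  · obtain ⟨ε, hε, h⟩ := h fun _ => x
    exact ⟨ε, hε, fun y hy hn => congrFun (h (fun _ => y) hy fun _ => hn) 0⟩
  · obtain ⟨ε, hε, h⟩ := h (x 0)
    refine ⟨ε, hε, fun y hy hn => funext fun i => ?_⟩
    rw [Subsingleton.elim i 0]
    exact h _ hy (hn 0)

/-- A discrete set is the increasing union of its bounded parts with a given lower bound for the
distance of each point to the others, and these are pseudo-finite. -/
theorem DiscretePFin.of_isDiscrete (hT : DiscretePFin L K) {S : Set X} [DefSet L K S]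
    (hS : IsDiscrete S) : PFin K S := by
  let F : K → Set X := fun t => {x | x ∈ S ∧ 0 < t ∧ Within t x ∧
    ∀ y, y ∈ S → Near t⁻¹ y x → y = x}
  have hF : DefFam L K F := inferInstanceAs (DefFam L K fun t : K => {x : X | x ∈ S ∧ 0 < t ∧
    Within t x ∧ ∀ y, y ∈ S → Near t⁻¹ y x → y = x})
  have h := hT.iUnion hF (fun s t hst x ⟨h1, h2, h3, h4⟩ => ⟨h1, h2.trans_le hst, h3.mono hst,
    fun y hy hn => h4 y hy (hn.mono (inv_anti₀ h2 hst))⟩) fun t => by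
      rcases le_or_gt t 0 with ht | ht
      · have : F t = ∅ := eq_empty_of_forall_notMem fun x hx => ht.not_gt hx.2.1
        rw [this]
        exact ⟨isClosed_empty, ⟨0, by simp⟩, subsingleton_empty.isDiscrete⟩
      · obtain ⟨hc, hd⟩ := isClosed_and_isDiscrete_of_separated (S := F t) (inv_pos.2 ht)
          fun x hx y hy hn => hy.2.2.2 x hx.1 hn
        exact ⟨hc, ⟨t, fun x hx => hx.2.2.1⟩, hd⟩
  refine h.mono fun x hx => ?_
  obtain ⟨ε, hε, hx'⟩ := isDiscrete_iff_near (K := K).1 hS x hx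
  obtain ⟨b, hb⟩ := exists_within (K := K) x
  refine mem_iUnion.2 ⟨max ε⁻¹ b, hx, lt_max_of_lt_left (inv_pos.2 hε),
    hb.mono (le_max_right _ _), fun y hy hn => hx' y hy (hn.mono ?_)⟩
  exact inv_le_of_inv_le₀ hε (le_max_left _ _)

theorem DiscretePFin.of_meagerNowhereDense (hT : DiscretePFin L K) {F : K → Set K}
    (hF : DefFam L K F) (hm : Monotone F) (hn : ∀ t, IsNowhereDense (F t)) :
    PFin K (⋃ t, F t) := by
  have := hF.iUnion
  exact hT.of_isNowhereDense (hT.meagerNowhereDense_self F hF hm hn)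

theorem discretePFin_of_iUnion (h : ∀ F : K → Set K, DefFam L K F → Monotone F →
    (∀ t, PFin K (F t)) → PFin K (⋃ t, F t)) : DiscretePFin L K := by
  intro D _ hd hc
  refine (h (fun t => {x | x ∈ D ∧ Within t x}) inferInstance
    (fun s t hst x hx => ⟨hx.1, hx.2.mono hst⟩) fun t => ?_).mono fun x hx => ?_
  · exact ⟨hc.inter (isClosed_within t), ⟨t, fun x hx => hx.2⟩, hd.mono fun x hx => hx.1⟩
  · obtain ⟨b, hb⟩ := exists_within (K := K) x
    exact mem_iUnion.2 ⟨b, hx, hb⟩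

theorem discretePFin_of_bddAbove (h : ∀ D : Set K, DefSet L K D → IsDiscrete D → IsClosed D →
    BddAbove D) : DiscretePFin L K := by
  intro D hD hd hc
  obtain ⟨b, hb⟩ := h D hD hd hc
  have hD' : DefSet L K {x : K | -x ∈ D} := inferInstance
  have hd' : IsDiscrete {x : K | -x ∈ D} :=
    hd.preimage (f := fun x : K => -x) continuous_neg.continuousOn neg_injective
  obtain ⟨a, ha⟩ := h _ hD' hd' (hc.preimage continuous_neg)
  refine pFin_iff.2 ⟨hc, ⟨⟨-a, fun x hx => ?_⟩, ⟨b, hb⟩⟩, hd⟩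
  exact neg_le.1 (ha (show -x ∈ {x : K | -x ∈ D} by simpa using hx))

omit [L.Structure K] hK in
theorem exists_mem_Ioo_notMem_of_isDiscrete {D : Set K} (hD : IsDiscrete D) {a b : K}
    (hab : a < b) : ∃ r ∈ Ioo a b, r ∉ D := by
  by_contra! h
  obtain ⟨m, hm⟩ := exists_between hab
  obtain ⟨ε, hε, hm'⟩ := isDiscrete_iff_near (K := K).1 hD m (h m hm)
  obtain ⟨z, hz1, hz2⟩ := exists_between (lt_min hm.2 (lt_add_of_pos_right m hε))
  have hzb := hz2.trans_le (min_le_left _ _)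
  have hzε := hz2.trans_le (min_le_right _ _)
  have := hm' z (h z ⟨hm.1.trans hz1, hzb⟩) (near_iff.2 (abs_lt.2 ⟨by linarith, by linarith⟩))
  exact hz1.ne' this

omit [L.Structure K] hK in
theorem isNowhereDense_of_isDiscrete {S : Set K} (hS : IsDiscrete S) : IsNowhereDense S := by
  refine isNowhereDense_iff_near (K := K).2 fun x ε hε => ?_
  by_cases hx : ∃ s ∈ S, Near ε s x
  · obtain ⟨s, hs, hsx⟩ := hx
    obtain ⟨δ, hδ, h⟩ := isDiscrete_iff_near (K := K).1 hS s hs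
    have hsx := abs_lt.1 (near_iff.1 hsx)
    have hm : 0 < min δ (x + ε - s) := lt_min hδ (by linarith)
    have h1 := min_le_left δ (x + ε - s)
    have h2 := min_le_right δ (x + ε - s)
    set η := min δ (x + ε - s)
    refine ⟨s + η / 2, near_iff.2 (abs_lt.2 ⟨by linarith, by linarith⟩), η / 2, half_pos hm,
      fun z hz hzS => ?_⟩
    have hz := abs_lt.1 (near_iff.1 hz)
    have := h z hzS (near_iff.2 (abs_lt.2 ⟨by linarith, by linarith⟩))
    linarith
  · push Not at hx
    exact ⟨x, near_self hε x, ε, hε, fun z hz hzS => hx z hzS hz⟩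

omit [L.Structure K] hK in
theorem isOpen_setOf_inv_notMem {D : Set K} (hD : IsClosed D) : IsOpen {x : K | 0 < x ∧ x⁻¹ ∉ D} :=
  ContinuousOn.isOpen_inter_preimage (f := fun x : K => x⁻¹)
    (continuousOn_inv₀.mono fun _ hx => (mem_Ioi.1 hx).ne') isOpen_Ioi hD.isOpen_compl

/-- For an unbounded closed discrete set `D`, the inverses of its positive elements form together
with `0` a closed set without interior in which `0` is not isolated. -/
theorem discretePFin_of_isDiscrete (h : ∀ A : Set K, DefSet L K A → IsNowhereDense A →
    IsDiscrete A) : DiscretePFin L K := by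
  refine discretePFin_of_bddAbove fun D _ hd hc => ?_
  let E : Set K := {x | x = 0 ∨ 0 < x ∧ x⁻¹ ∈ D}
  have hE : E = (Iio 0 ∪ {x : K | 0 < x ∧ x⁻¹ ∉ D})ᶜ := by
    ext x
    simp only [E, mem_ofPred_eq, mem_compl_iff, mem_union, mem_Iio]
    rcases lt_trichotomy x 0 with hx | rfl | hx
    · simp [hx, hx.ne, hx.not_gt]
    · simp
    · simp [hx, hx.ne', hx.not_gt]
  have hEc : IsClosed E := hE ▸ (isOpen_Iio.union (isOpen_setOf_inv_notMem hc)).isClosed_compl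
  have hEn : IsNowhereDense E := by
    rw [hEc.isNowhereDense_iff, eq_empty_iff_forall_notMem]
    intro z hz
    obtain ⟨ε, hε, hball⟩ := (mem_interior_near (K := K)).1 hz
    have hz0 : 0 ≤ z := by
      rcases interior_subset hz with h | h
      · exact h.ge
      · exact h.1.le
    have hw : 0 < z + ε / 2 := by linarith
    obtain ⟨r, ⟨hr1, hr2⟩, hrD⟩ := exists_mem_Ioo_notMem_of_isDiscrete hd
      (inv_strictAnti₀ hw (show z + ε / 2 < z + ε by linarith))
    have hr0 : 0 < r := (inv_pos.2 (by linarith)).trans hr1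
    have h1 : r⁻¹ < z + ε := inv_lt_of_inv_lt₀ (by linarith) hr1
    have h2 : z + ε / 2 < r⁻¹ := (lt_inv_comm₀ hr0 hw).1 hr2
    rcases hball r⁻¹ (near_iff.2 (abs_lt.2 ⟨by linarith, by linarith⟩)) with h | h
    · exact (inv_pos.2 hr0).ne' h
    · exact hrD (by simpa using h.2)
  obtain ⟨ε, hε, h0⟩ := isDiscrete_iff_near (K := K).1 (h E inferInstance hEn) 0 (.inl rfl)
  refine ⟨ε⁻¹, fun x hx => ?_⟩
  by_contra! hlt
  have hx0 : 0 < x := (inv_pos.2 hε).trans hlt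
  have := h0 x⁻¹ (.inr ⟨inv_pos.2 hx0, by simpa using hx⟩) (near_iff.2 (by
    rw [sub_zero, abs_of_pos (inv_pos.2 hx0)]
    exact inv_lt_of_inv_lt₀ hε hlt))
  exact (inv_pos.2 hx0).ne' this

/-- For an unbounded closed discrete set `D`, the characteristic function of the set of inverses
of positive elements of `D` is definable in the open core and has no constant sign to the right
of `0`. -/
theorem discretePFin_of_locallyOMinimal (h : LocallyOMinimal (openCore L K) K) :
    DiscretePFin L K := by
  classical
  refine discretePFin_of_bddAbove fun D _ hd hc => ?_
  let U : Set K := {x | 0 < x ∧ x⁻¹ ∉ D}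
  have hU : DefSet (openCore L K) K U :=
    defSet_openCore (inferInstanceAs (DefSet L K {x : K | 0 < x ∧ x⁻¹ ∉ D}))
      (isOpen_setOf_inv_notMem hc)
  let f : K → K := fun x => if x ∈ U then 0 else 1
  have hf : DefMap (openCore L K) K f := by
    refine ⟨DefPred.congr (P := fun p : K × K => p.1 ∈ U ∧ p.2 = 0 ∨ p.1 ∉ U ∧ p.2 = 1)
      inferInstance fun p => ?_⟩
    by_cases hp : p.1 ∈ U <;> simp [f, hp, eq_comm]
  obtain ⟨y, hy, hsign⟩ := h f (defMap_iff_defFun₁.1 hf) 0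
  obtain ⟨r, hr, hrD⟩ := exists_mem_Ioo_notMem_of_isDiscrete hd (lt_add_one y⁻¹)
  have hy' : 0 < y⁻¹ := inv_pos.2 hy
  have hr0 : 0 < r := hy'.trans hr.1
  have hr' : r⁻¹ ∈ Ioo 0 y := ⟨inv_pos.2 hr0, inv_lt_of_inv_lt₀ hy hr.1⟩
  have hfr : f r⁻¹ = 0 := if_pos ⟨hr'.1, by simpa using hrD⟩
  rcases hsign with hs | hs | hs
  · exact absurd hfr (hs _ hr').ne'
  · refine ⟨y⁻¹, fun x hx => ?_⟩
    by_contra! hlt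
    have hx0 : 0 < x := hy'.trans hlt
    have hfx : f x⁻¹ = 1 := if_neg fun hxU => hxU.2 (by simpa using hx)
    exact one_ne_zero (hfx.symm.trans (hs x⁻¹ ⟨inv_pos.2 hx0, inv_lt_of_inv_lt₀ hy hlt⟩))
  · exact absurd hfr (hs _ hr').ne

theorem FSigma.fSig {n : ℕ} {A : Set (Fin n → K)} (hA : FSigma L A) : FSig L K A := by
  obtain ⟨-, F, hF, hm, hc, h⟩ := hA
  exact ⟨F, defFam_iff_defFamily.2 hF, hm, hc, h⟩

theorem DiscretePFin.definablyBaire (hT : DiscretePFin L K) : DefinablyBaire L K := by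
  rintro ⟨F, hF, hm, hn, h⟩
  have := hT.meagerNowhereDense_self F (defFam_iff_defFamily₁.2 hF) hm hn
  rw [h, IsNowhereDense, closure_univ, interior_univ] at this
  exact univ_nonempty.ne_empty this

end Equivalences

end DefComplete

open DefComplete in
theorem mainTheorem1 (L : FirstOrder.Language.{u, v}) (K : Type w) [L.Structure K]
    [Field K] [LinearOrder K] [IsStrictOrderedRing K] [TopologicalSpace K] [OrderTopology K]
    (hexp : DefComplete.ExpandsOrderedField L K) (hdc : DefComplete.DefinablyComplete L K) :
    List.TFAE [
      -- definable discrete closed sets are pseudo-finite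
      ∀ X : Set K, DefComplete.Def₁ L X → IsDiscrete X → IsClosed X → DefComplete.PseudoFinite X,
      ∀ (n : ℕ) (X : Set (Fin n → K)), DefComplete.Def L X → IsDiscrete X → IsClosed X →
        DefComplete.PseudoFinite X,
      -- definable discrete sets are pseudo-finite
      ∀ X : Set K, DefComplete.Def₁ L X → IsDiscrete X → DefComplete.PseudoFinite X,
      ∀ (n : ℕ) (X : Set (Fin n → K)), DefComplete.Def L X → IsDiscrete X →
        DefComplete.PseudoFinite X,
      -- nowhere dense sets and meager sets
      ∀ X : Set K, DefComplete.Def₁ L X → IsNowhereDense X → DefComplete.PseudoFinite X,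
      ∀ X : Set K, DefComplete.Def₁ L X → DefComplete.Meager₁ L X → DefComplete.PseudoFinite X,
      ∀ X : Set K, DefComplete.Def₁ L X → IsNowhereDense X → IsDiscrete X,
      -- the open core
      DefComplete.LocallyOMinimal (DefComplete.openCore L K) K,
      -- increasing unions of pseudo-finite sets
      ∀ Y : K → Set K, DefComplete.DefFamily₁ L Y → Monotone Y →
        (∀ t, DefComplete.PseudoFinite (Y t)) → DefComplete.PseudoFinite (⋃ t, Y t),
      ∀ (n : ℕ) (Y : K → Set (Fin n → K)), DefComplete.DefFamily L Y → Monotone Y →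
        (∀ t, DefComplete.PseudoFinite (Y t)) → DefComplete.PseudoFinite (⋃ t, Y t)] ∧
    (DefComplete.LocallyOMinimal (DefComplete.openCore L K) K →
      (∀ (n : ℕ) (X : Set (Fin n → K)), DefComplete.FSigma L X → DefComplete.Constructible X) ∧
      DefComplete.DefinablyBaire L K ∧
      (∀ (n : ℕ) (X : Set (Fin n → K)), DefComplete.Meager L X → IsNowhereDense X)) := by
  have hK : DefCompleteField L K := ⟨hexp, hdc⟩
  constructor
  · simp only [← pFin_iff, ← pFin_pi_iff, ← defSet_iff_def, ← defSet_iff_def₁,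
      ← defFam_iff_defFamily, ← defFam_iff_defFamily₁]
    change List.TFAE [DiscretePFin L K, _, _, _, _, _, _, _, _, _]
    tfae_have 1 → 10 := fun hT n Y hY hm hf => hT.iUnion hY hm hf
    tfae_have 10 → 9 := fun h Y hY hm hf => by
      have hY' : DefFam L K fun t => {x : Fin 1 → K | x 0 ∈ Y t} := inferInstance
      have := h 1 _ hY' (fun s t hst x hx => hm hst hx) fun t => pFin_fin_one_iff.2 (hf t)
      rw [← pFin_fin_one_iff]
      convert! this using 1
      ext x
      simp
    tfae_have 9 → 1 := discretePFin_of_iUnion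
    tfae_have 1 → 4 := fun hT n X hX hd => hT.of_isDiscrete hd
    tfae_have 4 → 2 := fun h n X hX hd _ => h n X hX hd
    tfae_have 2 → 1 := fun h X hX hd hc => by
      have hX' : DefSet L K {x : Fin 1 → K | x 0 ∈ X} := inferInstance
      have hi : Function.Injective fun x : Fin 1 → K => x 0 := fun x y hxy =>
        funext fun i => Subsingleton.elim 0 i ▸ hxy
      exact pFin_fin_one_iff.1 (h 1 _ hX'
        (hd.preimage (continuous_apply (0 : Fin 1)).continuousOn hi)
        (hc.preimage (continuous_apply 0)))
    tfae_have 1 → 6 := by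
      rintro hT X - ⟨Y, hY, hm, hn, rfl⟩
      exact hT.of_meagerNowhereDense (defFam_iff_defFamily₁.2 hY) hm hn
    tfae_have 6 → 5 := fun h X hX hn => h X hX ⟨fun _ => X, defFam_iff_defFamily₁.1 ⟨inferInstance⟩,
      monotone_const, fun _ => hn, (Set.iUnion_const X).symm⟩
    tfae_have 5 → 7 := fun h X hX hn => (h X hX hn).isDiscrete
    tfae_have 7 → 1 := discretePFin_of_isDiscrete
    tfae_have 5 → 3 := fun h X hX hd => h X hX (isNowhereDense_of_isDiscrete hd)
    tfae_have 3 → 1 := fun h X hX hd _ => h X hX hd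
    tfae_have 1 → 8 := DiscretePFin.locallyOMinimal
    tfae_have 8 → 1 := discretePFin_of_locallyOMinimal
    tfae_finish
  · intro h
    have hT : DiscretePFin L K := discretePFin_of_locallyOMinimal h
    refine ⟨fun n X hX => hT.constructible hX.fSig, hT.definablyBaire, ?_⟩
    rintro n _ ⟨Y, hY, hm, hn, rfl⟩
    exact hT.meagerNowhereDense n Y (defFam_iff_defFamily.2 hY) hm hn
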